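/- For complex $A,B,C$ with $C\notin\{0,-1,-2,\dots\}$ let ${}_2F_1(A,B;C;z)$ denote the analytic continuation to $\mathbb C\setminus[1,\infty)$ of the series $\sum_{k\ge0}\frac{(A)_k(B)_k}{(C)_k\,k!}z^k$, where $(x)_k=x(x+1)\cdots(x+k-1)$. Let $n\ge 0$ be an integer. Then there are unique rational functions $P(n),Q(n)\in\mathbb C(a,b)$ such that $$ {}_2F_1(a+n,b;a-b;-1)=P(n)\,\frac{\Gamma(a-b)\,\Gamma(\frac{a+1}{2})}{\Gamma(a)\,\Gamma(\frac{a+1}{2}-b)}+Q(n)\,\frac{\Gamma(a-b)\,\Gamma(\frac a2)}{\Gamma(a)\,\Gamma(\frac a2-b)} \qquad(*) $$ at all complex $a,b$ where $P(n),Q(n)$ are defined, $(a)_n\ne0$, and $a-b$ is not zero or a negative integer. (Here $1/\Gamma$ is zero at the poles of $\Gamma$, and the two $\Gamma$-terms are understood by continuity in $a$ when $a$ is zero or a negative integer.) Moreover, for all complex $a,b$ such that $(a)_n\neq0$ and $a-b$ is not zero or a negative integer, $P(n)$ and $Q(n)$ are defined at $(a,b)$ and are given there by $$ P(n)=\frac12\;{}_3F_2\!\left(-\tfrac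 n2,\,-\tfrac{n+1}2,\,b;\;-n,\,\tfrac a2;\;1\right),\qquad Q(n)=\frac12\;{}_3F_2\!\left(-\tfrac{n-1}2,\,-\tfrac n2,\,b;\;-n,\,\tfrac{a+1}2;\;1\right), $$ so that $(*)$ holds with these values. The ${}_3F_2$ sums are read as terminating series: $$ P(n)=\frac12\sum_{k=0}^{\lceil n/2\rceil}\frac{(-\frac n2)_k\,(-\frac{n+1}2)_k\,(b)_k}{(-n)_k\,(\frac a2)_k\,k!},\qquad Q(n)=\frac12\sum_{k=0}^{\lfloor n/2\rfloor}\frac{(-\frac{n-1}2)_k\,(-\frac n2)_k\,(b)_k}{(-n)_k\,(\frac{a+1}2)_k\,k!}. $$ -/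

import Mathlib

open scoped Topology

noncomputable section

namespace Kummer

/-- The cut plane `ℂ ∖ [1, ∞)`. -/
def cutPlane : Set ℂ := {z | ¬ (z.im = 0 ∧ 1 ≤ z.re)}

/-- `F` is the analytic continuation to `ℂ ∖ [1, ∞)` of the Gauss hypergeometric series
`∑ (A)_k (B)_k / ((C)_k k!) z ^ k`, which is given on the open unit disc by Mathlib's `₂F₁`. -/
def IsGaussContinuation (A B C : ℂ) (F : ℂ → ℂ) : Prop :=
  DifferentiableOn ℂ F cutPlane ∧ ∀ z : ℂ, ‖z‖ < 1 → F z = ₂F₁ A B C z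

/-- The Gauss hypergeometric function on `ℂ ∖ [1, ∞)`: the analytic continuation of the
hypergeometric series (its values on the cut plane are unique, by the identity theorem). -/
def gauss2F1 (A B C : ℂ) : ℂ → ℂ :=
  Classical.epsilon (IsGaussContinuation A B C)

/-- The Pochhammer symbol `(x)_k = x (x + 1) ⋯ (x + k - 1)`. -/
def poch (x : ℂ) (k : ℕ) : ℂ := (ascPochhammer ℂ k).eval x

/-- The series `₃F₂(A, B, C; E, F; 1)`, terminated after the term of index `N`. -/
def terminating3F2 (N : ℕ) (A B C E F : ℂ) : ℂ :=
  ∑ k ∈ Finset.range (N + 1),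
    poch A k * poch B k * poch C k / (poch E k * poch F k * (k.factorial : ℂ))

/-- `½ ₃F₂(-n/2, -(n+1)/2, b; -n, a/2; 1)`. The summation ends at `⌈n/2⌉`, the one of `n/2` and
`(n+1)/2` that is an integer. -/
def P (n : ℕ) (a b : ℂ) : ℂ :=
  1 / 2 * terminating3F2 ((n + 1) / 2) (-(n : ℂ) / 2) (-((n : ℂ) + 1) / 2) b (-(n : ℂ)) (a / 2)

/-- `½ ₃F₂(-(n-1)/2, -n/2, b; -n, (a+1)/2; 1)`. The summation ends at `⌊n/2⌋`, the one of
`(n-1)/2` and `n/2` that is an integer. -/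
def Q (n : ℕ) (a b : ℂ) : ℂ :=
  1 / 2 * terminating3F2 (n / 2) (-((n : ℂ) - 1) / 2) (-(n : ℂ) / 2) b (-(n : ℂ)) ((a + 1) / 2)

/-- The Gamma term `Γ(a-b) Γ((a+1)/2) / (Γ(a) Γ((a+1)/2-b))`. If `a` is a pole of `Γ`, it is
understood by continuity in `a`; at all other `a` (with `a - b` not a pole), the limit is just the
value of the expression, with `1 / Γ` being zero at the poles of `Γ`. -/
def gammaTermP (a b : ℂ) : ℂ :=
  Filter.limUnder (𝓝[≠] a) fun z : ℂ =>
    Complex.Gamma (z - b) * Complex.Gamma ((z + 1) / 2) /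
      (Complex.Gamma z * Complex.Gamma ((z + 1) / 2 - b))

/-- The Gamma term `Γ(a-b) Γ(a/2) / (Γ(a) Γ(a/2-b))`, understood by continuity in `a` in the same
way. -/
def gammaTermQ (a b : ℂ) : ℂ :=
  Filter.limUnder (𝓝[≠] a) fun z : ℂ =>
    Complex.Gamma (z - b) * Complex.Gamma (z / 2) /
      (Complex.Gamma z * Complex.Gamma (z / 2 - b))

/-- The hypotheses on the parameters: `(a)_n ≠ 0`, and `a - b` is not zero or a negative
integer. -/
def Admissible (n : ℕ) (a b : ℂ) : Prop :=
  poch a n ≠ 0 ∧ ∀ m : ℕ, a - b ≠ -(m : ℂ)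

/-- The generalized Kummer formula at `(a, b)`, with the values `p` and `q` for its two
coefficients. -/
def GeneralizedKummer (n : ℕ) (a b p q : ℂ) : Prop :=
  gauss2F1 (a + n) b (a - b) (-1) = p * gammaTermP a b + q * gammaTermQ a b

/-- The field `ℂ(a, b)` of rational functions in two variables. -/
abbrev RationalFunction : Type := FractionRing (MvPolynomial (Fin 2) ℂ)

/-- The rational function `R` is defined at the point `(a, b)` and has the value `v` there. -/
def HasValueAt (R : RationalFunction) (a b v : ℂ) : Prop :=
  ∃ f g : MvPolynomial (Fin 2) ℂ, MvPolynomial.eval ![a, b] g ≠ 0 ∧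
    R = algebraMap _ RationalFunction f / algebraMap _ RationalFunction g ∧
    v = MvPolynomial.eval ![a, b] f / MvPolynomial.eval ![a, b] g

/-- `p` and `q` are rational functions of `a, b` that can serve as the coefficients in the
generalized Kummer formula with shift `n`. -/
def IsCoefficientPair (n : ℕ) (p q : RationalFunction) : Prop :=
  ∀ a b u v : ℂ, Admissible n a b → HasValueAt p a b u → HasValueAt q a b v →
    GeneralizedKummer n a b u v

end Kummer

end

noncomputable section

namespace Kummer


/-! ### Pochhammer symbols -/

/-! Write F(A, B; C) for the continued Gauss function at z = -1. Kummer's theorem evaluates F(a, b;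
1+a-b) (`gauss2F1_kummer`). Replacing a by a-1, or b by b+1, makes the third parameter a-b: by
Legendre duplication the P-term is F(a-1, b; a-b) and the Q-term is 2 F(a, b+1; a-b). So the formula
expresses a contiguous function in terms of two known ones.

A contiguous relation among F(a, b), F(a-1, b) and F(a, b+1) settles n = 0 (`gauss2F1_self`). After
that, F(A+1, B; C) = F(A, B; C) - (B/C) F(A+1, B+1; C+1) expresses case n+2 at (a, b) by case n+1 at
(a, b) and case n at (a+2, b+1) (`gauss2F1_shift`). The Gamma terms at (a+2, b+1) are elementary
multiples of those at (a, b), so P and Q need only satisfy `P_add_two` and `Q_add_two`. Up to powers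
of -1/4, the coefficients of these sums are those of the Lucas and Fibonacci polynomials, and the
recurrences are Pascal's rule.

The continuation is built from Euler's integral where it converges and from contiguous relations
elsewhere (`exists_isGaussContinuation`). Relations are checked coefficientwise on the disc and
carried to -1 by the identity theorem. Kummer's theorem likewise starts from Euler's integral, which
at z = -1 becomes a Beta integral under x = t², and spreads by relations whose third term has a
factor 1+z.

For uniqueness (`IsCoefficientPair.unique`), one Gamma term vanishes and the other does not on a
suitable infinite grid; such a grid is Zariski dense, so each coefficient is determined. -/

theorem poch_zero (x : ℂ) : poch x 0 = 1 := by simp [poch]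

theorem poch_succ (x : ℂ) (k : ℕ) : poch x (k + 1) = poch x k * (x + k) :=
  ascPochhammer_succ_eval k x

theorem poch_succ_left (x : ℂ) (k : ℕ) : poch x (k + 1) = x * poch (x + 1) k := by
  simp [poch, ascPochhammer_succ_left, Polynomial.eval_comp]

theorem poch_ne_zero_of_forall {x : ℂ} (h : ∀ m : ℕ, x ≠ -(m : ℂ)) (k : ℕ) : poch x k ≠ 0 := by
  intro h0
  obtain ⟨m, -, hm⟩ := (ascPochhammer_eval_eq_zero_iff k x).1 h0
  exact h m (by rw [hm, neg_neg])

/-! ### The Gauss series on the unit disc -/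

theorem _root_.HasSum.congr_forall {f g : ℕ → ℂ} {S : ℂ} (h : HasSum f S) (hfg : ∀ k, f k = g k) :
    HasSum g S := funext hfg ▸ h

/-- The coefficient of `z ^ k` in the Gauss hypergeometric series. -/
def gaussCoeff (A B C : ℂ) (k : ℕ) : ℂ := poch A k * poch B k / (poch C k * k.factorial)

theorem gaussCoeff_zero (A B C : ℂ) : gaussCoeff A B C 0 = 1 := by simp [gaussCoeff, poch_zero]

/-- If one of the parameters is a non-positive integer, the series terminates and the radius is
infinite; for C this is due to the convention that division by zero gives zero. -/
theorem one_le_radius_ordinaryHypergeometricSeries (A B C : ℂ) :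
    1 ≤ (ordinaryHypergeometricSeries ℂ A B C).radius := by
  by_cases h : ∀ k : ℕ, (k : ℂ) ≠ -A ∧ (k : ℂ) ≠ -B ∧ (k : ℂ) ≠ -C
  · rw [ordinaryHypergeometricSeries_radius_eq_one ℂ A B C h]
  · push Not at h
    obtain ⟨k, hk⟩ := h
    by_cases hA : (k : ℂ) = -A
    · rw [← neg_eq_iff_eq_neg.2 hA, ordinaryHypergeometric_radius_top_of_neg_nat₁]; exact le_top
    by_cases hB : (k : ℂ) = -B
    · rw [← neg_eq_iff_eq_neg.2 hB, ordinaryHypergeometric_radius_top_of_neg_nat₂]; exact le_top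
    · rw [← neg_eq_iff_eq_neg.2 (hk hA hB), ordinaryHypergeometric_radius_top_of_neg_nat₃]
      exact le_top

theorem hasSum_gaussCoeff (A B C : ℂ) {z : ℂ} (hz : ‖z‖ < 1) :
    HasSum (fun k => gaussCoeff A B C k * z ^ k) (₂F₁ A B C z) := by
  have hmem : z ∈ Metric.eball (0 : ℂ) (ordinaryHypergeometricSeries ℂ A B C).radius := by
    refine Metric.eball_subset_eball (one_le_radius_ordinaryHypergeometricSeries A B C) ?_
    rw [← ENNReal.ofReal_one, Metric.eball_ofReal]
    simpa using hz
  have h := FormalMultilinearSeries.hasSum (ordinaryHypergeometricSeries ℂ A B C) hmem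
  rw [ordinaryHypergeometricSeries_apply_eq'] at h
  refine h.congr_forall fun k => ?_
  simp only [gaussCoeff, poch, smul_eq_mul, div_eq_mul_inv, mul_inv]
  ring

/-- Lets contiguous relations containing a factor z be compared coefficient by coefficient. -/
theorem hasSum_shift {f : ℕ → ℂ} {z S : ℂ} (h : HasSum (fun k => f k * z ^ k) S) :
    HasSum (fun k => (if k = 0 then 0 else f (k - 1)) * z ^ k) (z * S) := by
  rw [← hasSum_nat_add_iff' 1]
  simpa [pow_succ, mul_comm, mul_left_comm, mul_assoc] using h.mul_left z

/-! ### The cut plane -/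

theorem mem_cutPlane_iff {z : ℂ} : z ∈ cutPlane ↔ 1 - z ∈ Complex.slitPlane := by
  simp only [cutPlane, Set.mem_ofPred_eq, Complex.mem_slitPlane_iff, Complex.sub_re, Complex.one_re,
    Complex.sub_im, Complex.one_im, zero_sub, ne_eq, neg_eq_zero, sub_pos, not_and_or, not_le]
  tauto

theorem isOpen_cutPlane : IsOpen cutPlane := by
  have : cutPlane = (fun z : ℂ => 1 - z) ⁻¹' Complex.slitPlane := by
    ext z; exact mem_cutPlane_iff
  rw [this]
  exact Complex.isOpen_slitPlane.preimage (by fun_prop)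

theorem starConvex_cutPlane : StarConvex ℝ 0 cutPlane := by
  intro z hz s t hs ht hst
  rw [mem_cutPlane_iff] at hz ⊢
  have := Complex.starConvex_one_slitPlane hz hs ht hst
  convert this using 1
  simp only [smul_zero, zero_add, Complex.real_smul, mul_one, mul_sub]
  rw [← add_sub_assoc, ← Complex.ofReal_add, hst, Complex.ofReal_one]

theorem zero_mem_cutPlane : (0 : ℂ) ∈ cutPlane := by simp [cutPlane]

theorem neg_one_mem_cutPlane : (-1 : ℂ) ∈ cutPlane := by norm_num [cutPlane]

theorem isPreconnected_cutPlane : IsPreconnected cutPlane :=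
  (starConvex_cutPlane.isPathConnected zero_mem_cutPlane).isConnected.isPreconnected

theorem eq_zero_of_forall_norm_lt_one {G : ℂ → ℂ} (hG : DifferentiableOn ℂ G cutPlane)
    (h : ∀ z : ℂ, ‖z‖ < 1 → G z = 0) {z : ℂ} (hz : z ∈ cutPlane) : G z = 0 := by
  have hA : AnalyticOnNhd ℂ G cutPlane := hG.analyticOnNhd isOpen_cutPlane
  refine hA.eqOn_zero_of_preconnected_of_eventuallyEq_zero isPreconnected_cutPlane
    zero_mem_cutPlane ?_ hz
  filter_upwards [Metric.ball_mem_nhds (0 : ℂ) one_pos] with w hw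
  exact h w (by simpa using hw)

theorem IsGaussContinuation.eq {A B C : ℂ} {F G : ℂ → ℂ} (hF : IsGaussContinuation A B C F)
    (hG : IsGaussContinuation A B C G) {z : ℂ} (hz : z ∈ cutPlane) : F z = G z := by
  refine sub_eq_zero.1 (eq_zero_of_forall_norm_lt_one (G := fun z => F z - G z)
    (hF.1.sub hG.1) (fun w hw => ?_) hz)
  rw [hF.2 w hw, hG.2 w hw, sub_self]


open MeasureTheory

/-! ### Euler's integral -/

/-- The weight `t ^ (u - 1) (1 - t) ^ (v - 1)` of the Beta integral. -/
def betaWeight (u v : ℂ) (t : ℝ) : ℂ := (t : ℂ) ^ (u - 1) * (1 - (t : ℂ)) ^ (v - 1)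

/-- Euler's integral for the Gauss hypergeometric function, without its Gamma factor. -/
def eulerIntegral (A B C z : ℂ) : ℂ :=
  ∫ t : ℝ in 0..1, betaWeight B (C - B) t * (1 - z * t) ^ (-A)

theorem one_sub_mul_mem_slitPlane {z : ℂ} (hz : z ∈ cutPlane) {t : ℝ} (ht : t ∈ Set.Icc (0 : ℝ) 1) :
    1 - z * t ∈ Complex.slitPlane := by
  rw [← mem_cutPlane_iff]
  have := starConvex_cutPlane.smul_mem hz ht.1 ht.2
  rwa [Complex.real_smul, mul_comm] at this

theorem uIoc_zero_one_subset : Set.uIoc (0 : ℝ) 1 ⊆ Set.Icc 0 1 := by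
  rw [Set.uIoc_of_le zero_le_one]; exact Set.Ioc_subset_Icc_self

theorem continuousOn_one_sub_mul_cpow (s : ℂ) :
    ContinuousOn (fun p : ℂ × ℝ => (1 - p.1 * p.2) ^ s) (cutPlane ×ˢ Set.Icc (0 : ℝ) 1) := by
  refine ContinuousOn.cpow_const (by fun_prop) ?_
  rintro ⟨z, t⟩ ⟨hz, ht⟩
  exact one_sub_mul_mem_slitPlane hz ht

theorem differentiableOn_eulerIntegral {A B C : ℂ} (hB : 0 < B.re) (hCB : 0 < (C - B).re) :
    DifferentiableOn ℂ (eulerIntegral A B C) cutPlane := by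
  intro z₀ hz₀
  have hw : IntervalIntegrable (betaWeight B (C - B)) volume 0 1 :=
    Complex.betaIntegral_convergent hB hCB
  obtain ⟨r, hr, hsub⟩ := Metric.nhds_basis_closedBall.mem_iff.1 (isOpen_cutPlane.mem_nhds hz₀)
  have hcont : ∀ s : ℂ, ∀ z ∈ cutPlane,
      ContinuousOn (fun t : ℝ => (1 - z * (t : ℂ)) ^ s) (Set.Icc 0 1) := fun s z hz =>
    (continuousOn_one_sub_mul_cpow s).comp (f := fun t : ℝ => (z, t)) (by fun_prop)
      fun t ht => ⟨hz, ht⟩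
  have hmeas : ∀ s : ℂ, ∀ z ∈ cutPlane,
      AEStronglyMeasurable (fun t : ℝ => (1 - z * (t : ℂ)) ^ s)
        (volume.restrict (Set.uIoc (0 : ℝ) 1)) := fun s z hz =>
    ((hcont s z hz).mono uIoc_zero_one_subset).aestronglyMeasurable measurableSet_uIoc
  have hwmeas : AEStronglyMeasurable (betaWeight B (C - B))
      (volume.restrict (Set.uIoc (0 : ℝ) 1)) := (intervalIntegrable_iff.1 hw).aestronglyMeasurable
  -- Only the Beta weight is singular, and it does not involve z; the other factor of the derivative
  -- is bounded by compactness, so a multiple of the weight dominates.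
  obtain ⟨M, hM⟩ := ((isCompact_closedBall z₀ r).prod (isCompact_Icc (a := (0 : ℝ)) (b := 1)))
    |>.exists_bound_of_continuousOn
      ((continuousOn_one_sub_mul_cpow (-A - 1)).mono (Set.prod_mono hsub subset_rfl))
  refine ((intervalIntegral.hasDerivAt_integral_of_dominated_loc_of_deriv_le
    (F := fun z t => betaWeight B (C - B) t * (1 - z * t) ^ (-A))
    (F' := fun z t => betaWeight B (C - B) t * (A * t * (1 - z * t) ^ (-A - 1)))
    (bound := fun t => ‖betaWeight B (C - B) t‖ * (‖A‖ * M))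
    (Metric.closedBall_mem_nhds z₀ hr) ?_ ?_ ?_ ?_ ?_ ?_).2.differentiableAt).differentiableWithinAt
  · filter_upwards [isOpen_cutPlane.mem_nhds hz₀] with z hz
    exact hwmeas.mul (hmeas _ z hz)
  · refine hw.mul_continuousOn ?_
    rw [Set.uIcc_of_le zero_le_one]
    exact hcont _ z₀ hz₀
  · refine hwmeas.mul (AEStronglyMeasurable.mul ?_ (hmeas _ z₀ hz₀))
    exact (by fun_prop : Continuous fun t : ℝ => A * (t : ℂ)).aestronglyMeasurable
  · refine Filter.Eventually.of_forall fun t ht z hz => ?_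
    have ht' := uIoc_zero_one_subset ht
    rw [norm_mul, norm_mul, norm_mul]
    have h1 : ‖(t : ℂ)‖ ≤ 1 := by
      rw [Complex.norm_real, Real.norm_of_nonneg ht'.1]; exact ht'.2
    have h2 := hM (z, t) ⟨hz, ht'⟩
    refine mul_le_mul_of_nonneg_left ?_ (norm_nonneg _)
    refine mul_le_mul ?_ h2 (norm_nonneg _) (norm_nonneg _)
    exact mul_le_of_le_one_right (norm_nonneg _) h1
  · exact hw.norm.mul_const _
  · refine Filter.Eventually.of_forall fun t ht z hz => ?_
    have ht' := uIoc_zero_one_subset ht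
    have h1 : HasDerivAt (fun z : ℂ => 1 - z * (t : ℂ)) (-(t : ℂ)) z := by
      simpa using ((hasDerivAt_id z).mul_const (t : ℂ)).const_sub 1
    have h2 := (h1.cpow_const (c := -A) (one_sub_mul_mem_slitPlane (hsub hz) ht')).const_mul
      (betaWeight B (C - B) t)
    refine h2.congr_deriv ?_
    ring

theorem hasSum_one_sub_cpow (A : ℂ) {x : ℂ} (hx : ‖x‖ < 1) :
    HasSum (fun k : ℕ => poch A k / k.factorial * x ^ k) ((1 - x) ^ (-A)) := by
  have hmem : -x ∈ Metric.eball (0 : ℂ) 1 := by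
    rw [← ENNReal.ofReal_one, Metric.eball_ofReal]
    simpa using hx
  have h := (Complex.one_add_cpow_hasFPowerSeriesOnBall_zero (a := -A)).hasSum hmem
  rw [zero_add, ← sub_eq_add_neg] at h
  refine h.congr_forall fun k => ?_
  -- The binomial series is read as ₂F₁(A, 1; 1), whose auxiliary parameter 1 cancels since (1)_k ≠
  -- 0.
  have h1 : ∀ j : ℕ, (j : ℂ) ≠ -1 := fun j hj => by
    have : ((j + 1 : ℕ) : ℂ) = 0 := by push_cast; rw [hj]; ring
    exact (Nat.cast_ne_zero.2 (Nat.succ_ne_zero j)) this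
  have h2 : (ascPochhammer ℂ k).eval 1 ≠ 0 := by
    rw [ne_eq, ascPochhammer_eval_eq_zero_iff]
    rintro ⟨j, -, hj⟩
    exact h1 j hj
  rw [binomialSeries_eq_ordinaryHypergeometricSeries h1]
  simp only [FormalMultilinearSeries.compContinuousLinearMap_apply, Function.comp_def]
  simp only [FunLike.coe_neg, Pi.neg_apply, ContinuousLinearMap.id_apply, neg_neg]
  rw [ordinaryHypergeometricSeries_apply_eq, mul_inv_cancel_right₀ h2, smul_eq_mul, poch]
  ring

theorem norm_mul_ofReal_lt_one {z : ℂ} (hz : ‖z‖ < 1) {t : ℝ} (ht : t ∈ Set.Icc (0 : ℝ) 1) :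
    ‖z * t‖ < 1 := by
  rw [norm_mul, Complex.norm_real, Real.norm_of_nonneg ht.1]
  exact lt_of_le_of_lt (mul_le_of_le_one_right (norm_nonneg _) ht.2) hz

theorem ne_neg_nat_of_re_pos {C : ℂ} (hC : 0 < C.re) (m : ℕ) : C ≠ -(m : ℂ) := by
  rintro rfl
  simp only [Complex.neg_re, Complex.natCast_re, Left.neg_pos_iff] at hC
  exact absurd hC (not_lt.2 (Nat.cast_nonneg m))

theorem Gamma_add_nat {s : ℂ} (hs : 0 < s.re) (k : ℕ) :
    Complex.Gamma (s + k) = poch s k * Complex.Gamma s := by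
  induction k with
  | zero => simp [poch_zero]
  | succ k ih =>
    have h0 : s + k ≠ 0 := fun h => ne_neg_nat_of_re_pos hs k (eq_neg_of_add_eq_zero_left h)
    rw [Nat.cast_succ, ← add_assoc, Complex.Gamma_add_one _ h0, ih, poch_succ]
    ring

theorem betaIntegral_add_nat {B D : ℂ} (hB : 0 < B.re) (hD : 0 < D.re) (k : ℕ) :
    Complex.betaIntegral (B + k) D = poch B k / poch (B + D) k * Complex.betaIntegral B D := by
  have hBD : 0 < (B + D).re := by rw [Complex.add_re]; exact add_pos hB hD
  have hBk : 0 < (B + k).re := by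
    rw [Complex.add_re, Complex.natCast_re]; exact add_pos_of_pos_of_nonneg hB (Nat.cast_nonneg k)
  rw [Complex.betaIntegral_eq_Gamma_mul_div _ _ hBk hD,
    Complex.betaIntegral_eq_Gamma_mul_div _ _ hB hD, add_right_comm, Gamma_add_nat hB, Gamma_add_nat hBD]
  have h1 := Complex.Gamma_ne_zero_of_re_pos hBD
  have h2 := poch_ne_zero_of_forall (ne_neg_nat_of_re_pos hBD) k
  field_simp

/-- Expand (1 - zt)^(-A) by the binomial series and integrate termwise; the k-th term is a Beta
integral with first argument B + k, which contributes (B)_k / (C)_k. -/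
theorem eulerIntegral_eq {A B C : ℂ} (hB : 0 < B.re) (hCB : 0 < (C - B).re) {z : ℂ}
    (hz : ‖z‖ < 1) :
    eulerIntegral A B C z = Complex.betaIntegral B (C - B) * ₂F₁ A B C z := by
  have hw : IntervalIntegrable (betaWeight B (C - B)) volume 0 1 :=
    Complex.betaIntegral_convergent hB hCB
  have hwmeas : AEStronglyMeasurable (betaWeight B (C - B))
      (volume.restrict (Set.uIoc (0 : ℝ) 1)) := (intervalIntegrable_iff.1 hw).aestronglyMeasurable
  have hsummable : Summable fun k : ℕ => ‖poch A k / k.factorial * z ^ k‖ :=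
    (hasSum_one_sub_cpow A hz).summable.norm
  have key := intervalIntegral.hasSum_integral_of_dominated_convergence (μ := volume)
    (a := 0) (b := 1)
    (F := fun (k : ℕ) (t : ℝ) => betaWeight B (C - B) t * (poch A k / k.factorial * (z * t) ^ k))
    (f := fun t : ℝ => betaWeight B (C - B) t * (1 - z * t) ^ (-A))
    (fun k t => ‖betaWeight B (C - B) t‖ * ‖poch A k / k.factorial * z ^ k‖)
    (fun k => hwmeas.mul (by fun_prop : Continuous fun t : ℝ =>
      poch A k / k.factorial * (z * (t : ℂ)) ^ k).aestronglyMeasurable)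
    (fun k => Filter.Eventually.of_forall fun t ht => ?_)
    (Filter.Eventually.of_forall fun t _ => hsummable.mul_left _)
    (by simp only [tsum_mul_left]; exact hw.norm.mul_const _)
    (Filter.Eventually.of_forall fun t ht =>
      (hasSum_one_sub_cpow A (norm_mul_ofReal_lt_one hz (uIoc_zero_one_subset ht))).mul_left _)
  · have key2 := (hasSum_gaussCoeff A B C hz).mul_left (Complex.betaIntegral B (C - B))
    refine key.unique (key2.congr_forall fun k => ?_)
    have h1 : ∫ t : ℝ in 0..1, betaWeight B (C - B) t * (poch A k / k.factorial * (z * t) ^ k) =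
        poch A k / k.factorial * z ^ k * Complex.betaIntegral (B + k) (C - B) := by
      rw [Complex.betaIntegral, ← intervalIntegral.integral_const_mul]
      refine intervalIntegral.integral_congr_ae (Filter.Eventually.of_forall fun t ht => ?_)
      rw [Set.uIoc_of_le zero_le_one] at ht
      have ht0 : (t : ℂ) ≠ 0 := Complex.ofReal_ne_zero.2 ht.1.ne'
      rw [betaWeight, add_sub_right_comm, Complex.cpow_add _ _ ht0, Complex.cpow_natCast, mul_pow]
      ring
    rw [h1, betaIntegral_add_nat hB hCB, add_sub_cancel, gaussCoeff]
    field_simp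
  · have ht' := uIoc_zero_one_subset ht
    rw [norm_mul, norm_mul, norm_mul, mul_pow, norm_mul, norm_pow (t : ℂ), Complex.norm_real,
      Real.norm_of_nonneg ht'.1]
    gcongr
    exact mul_le_of_le_one_right (norm_nonneg _) (pow_le_one₀ ht'.1 ht'.2)

theorem betaIntegral_ne_zero {u v : ℂ} (hu : 0 < u.re) (hv : 0 < v.re) :
    Complex.betaIntegral u v ≠ 0 := by
  rw [Complex.betaIntegral_eq_Gamma_mul_div _ _ hu hv]
  have huv : 0 < (u + v).re := by rw [Complex.add_re]; exact add_pos hu hv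
  exact div_ne_zero (mul_ne_zero (Complex.Gamma_ne_zero_of_re_pos hu)
    (Complex.Gamma_ne_zero_of_re_pos hv)) (Complex.Gamma_ne_zero_of_re_pos huv)

theorem isGaussContinuation_eulerIntegral {A B C : ℂ} (hB : 0 < B.re) (hCB : 0 < (C - B).re) :
    IsGaussContinuation A B C
      fun z => eulerIntegral A B C z / Complex.betaIntegral B (C - B) := by
  refine ⟨(differentiableOn_eulerIntegral hB hCB).div_const _, fun z hz => ?_⟩
  change eulerIntegral A B C z / _ = _
  rw [eulerIntegral_eq hB hCB hz, mul_div_cancel_left₀ _ (betaIntegral_ne_zero hB hCB)]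


/-! ### Contiguous relations on the unit disc -/

theorem add_nat_ne_zero {C : ℂ} (hC : ∀ m : ℕ, C ≠ -(m : ℂ)) (m : ℕ) : C + m ≠ 0 :=
  fun h => hC m (eq_neg_of_add_eq_zero_left h)

theorem add_one_ne_neg_nat {C : ℂ} (hC : ∀ m : ℕ, C ≠ -(m : ℂ)) (m : ℕ) : C + 1 ≠ -(m : ℂ) :=
  fun h => hC (m + 1) (by push_cast; linear_combination h)

theorem add_two_ne_neg_nat {C : ℂ} (hC : ∀ m : ℕ, C ≠ -(m : ℂ)) (m : ℕ) : C + 2 ≠ -(m : ℂ) :=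
  fun h => hC (m + 2) (by push_cast; linear_combination h)

theorem poch_add_one_succ (x : ℂ) (k : ℕ) : poch (x + 1) (k + 1) = poch (x + 1) k * (x + 1 + k) :=
  poch_succ (x + 1) k

theorem poch_add_two {x : ℂ} (hx : x + 1 ≠ 0) (k : ℕ) :
    poch (x + 2) k = poch (x + 1) k * (x + 1 + k) / (x + 1) := by
  rw [← poch_succ, poch_succ_left, mul_div_cancel_left₀ _ hx, add_assoc, one_add_one_eq_two]

theorem cast_factorial_succ (k : ℕ) :
    ((k + 1).factorial : ℂ) = (k + 1) * (k.factorial : ℂ) := by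
  rw [Nat.factorial_succ]; push_cast; ring

/-- Raising the second and the third parameter. -/
theorem ordinaryHypergeometric_raise_second {A B C : ℂ} (hC : ∀ m : ℕ, C ≠ -(m : ℂ)) {z : ℂ}
    (hz : ‖z‖ < 1) :
    ₂F₁ A B C z = ₂F₁ A (B + 1) (C + 1) z -
      A * (C - B) / (C * (C + 1)) * (z * ₂F₁ (A + 1) (B + 1) (C + 2) z) := by
  refine (hasSum_gaussCoeff A B C hz).unique (((hasSum_gaussCoeff A (B + 1) (C + 1) hz).sub
    ((hasSum_shift (hasSum_gaussCoeff (A + 1) (B + 1) (C + 2) hz)).mul_left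
      (A * (C - B) / (C * (C + 1))))).congr_forall fun k => ?_)
  have h0 : C ≠ 0 := by simpa using add_nat_ne_zero hC 0
  have h1 : C + 1 ≠ 0 := by simpa using add_nat_ne_zero hC 1
  obtain _ | k := k
  · simp [gaussCoeff_zero]
  · have hf : (k.factorial : ℂ) ≠ 0 := Nat.cast_ne_zero.2 k.factorial_ne_zero
    have hk : (k : ℂ) + 1 ≠ 0 := Nat.cast_add_one_ne_zero k
    have hv := poch_ne_zero_of_forall (add_one_ne_neg_nat hC) k
    have hCk := add_nat_ne_zero (add_one_ne_neg_nat hC) k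
    simp only [Nat.add_eq_zero_iff, one_ne_zero, and_false, if_false, Nat.add_sub_cancel,
      gaussCoeff, poch_succ_left A, poch_succ_left B, poch_succ_left C, poch_add_one_succ B,
      poch_add_one_succ C, poch_add_two h1, cast_factorial_succ]
    field_simp
    ring

/-- Raising the third parameter. -/
theorem ordinaryHypergeometric_raise_third {A B C : ℂ} (hC : ∀ m : ℕ, C ≠ -(m : ℂ)) {z : ℂ}
    (hz : ‖z‖ < 1) :
    ₂F₁ A B C z = ₂F₁ A B (C + 1) z +
      A * B / (C * (C + 1)) * (z * ₂F₁ (A + 1) (B + 1) (C + 2) z) := by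
  refine (hasSum_gaussCoeff A B C hz).unique (((hasSum_gaussCoeff A B (C + 1) hz).add
    ((hasSum_shift (hasSum_gaussCoeff (A + 1) (B + 1) (C + 2) hz)).mul_left
      (A * B / (C * (C + 1))))).congr_forall fun k => ?_)
  have h0 : C ≠ 0 := by simpa using add_nat_ne_zero hC 0
  have h1 : C + 1 ≠ 0 := by simpa using add_nat_ne_zero hC 1
  obtain _ | k := k
  · simp [gaussCoeff_zero]
  · have hf : (k.factorial : ℂ) ≠ 0 := Nat.cast_ne_zero.2 k.factorial_ne_zero
    have hk : (k : ℂ) + 1 ≠ 0 := Nat.cast_add_one_ne_zero k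
    have hv := poch_ne_zero_of_forall (add_one_ne_neg_nat hC) k
    have hCk := add_nat_ne_zero (add_one_ne_neg_nat hC) k
    simp only [Nat.add_eq_zero_iff, one_ne_zero, and_false, if_false, Nat.add_sub_cancel,
      gaussCoeff, poch_succ_left A, poch_succ_left B, poch_succ_left C,
      poch_add_one_succ C, poch_add_two h1, cast_factorial_succ]
    field_simp
    ring

/-- Raising the first parameter. -/
theorem ordinaryHypergeometric_raise_first {A B C : ℂ} (hC : ∀ m : ℕ, C ≠ -(m : ℂ)) {z : ℂ}
    (hz : ‖z‖ < 1) :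
    ₂F₁ (A + 1) B C z = ₂F₁ A B C z + B / C * (z * ₂F₁ (A + 1) (B + 1) (C + 1) z) := by
  refine (hasSum_gaussCoeff (A + 1) B C hz).unique (((hasSum_gaussCoeff A B C hz).add
    ((hasSum_shift (hasSum_gaussCoeff (A + 1) (B + 1) (C + 1) hz)).mul_left
      (B / C))).congr_forall fun k => ?_)
  have h0 : C ≠ 0 := by simpa using add_nat_ne_zero hC 0
  obtain _ | k := k
  · simp [gaussCoeff_zero]
  · have hf : (k.factorial : ℂ) ≠ 0 := Nat.cast_ne_zero.2 k.factorial_ne_zero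
    have hk : (k : ℂ) + 1 ≠ 0 := Nat.cast_add_one_ne_zero k
    have hv := poch_ne_zero_of_forall (add_one_ne_neg_nat hC) k
    simp only [Nat.add_eq_zero_iff, one_ne_zero, and_false, if_false, Nat.add_sub_cancel,
      gaussCoeff, poch_succ_left A, poch_add_one_succ A, poch_succ_left B, poch_succ_left C,
      cast_factorial_succ]
    field_simp
    ring

/-- Lowering the first and raising the second parameter. -/
theorem ordinaryHypergeometric_lower_first_raise_second {A B C : ℂ}
    (hC : ∀ m : ℕ, C ≠ -(m : ℂ)) {z : ℂ} (hz : ‖z‖ < 1) :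
    (C - (A + 1) - B) * ₂F₁ (A + 1) B C z = (C - (A + 1)) * ₂F₁ A B C z +
      B * (z * ₂F₁ (A + 1) (B + 1) C z) - B * ₂F₁ (A + 1) (B + 1) C z := by
  refine ((hasSum_gaussCoeff (A + 1) B C hz).mul_left _).unique
    (((((hasSum_gaussCoeff A B C hz).mul_left (C - (A + 1))).add
    ((hasSum_shift (hasSum_gaussCoeff (A + 1) (B + 1) C hz)).mul_left B)).sub
    ((hasSum_gaussCoeff (A + 1) (B + 1) C hz).mul_left B)).congr_forall fun k => ?_)
  obtain _ | k := k
  · simp [gaussCoeff_zero]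
  · have hf : (k.factorial : ℂ) ≠ 0 := Nat.cast_ne_zero.2 k.factorial_ne_zero
    have hk : (k : ℂ) + 1 ≠ 0 := Nat.cast_add_one_ne_zero k
    have hv := poch_ne_zero_of_forall hC k
    have hCk := add_nat_ne_zero hC k
    simp only [Nat.add_eq_zero_iff, one_ne_zero, and_false, if_false, Nat.add_sub_cancel,
      gaussCoeff, poch_succ_left A, poch_add_one_succ A, poch_succ_left B, poch_add_one_succ B,
      poch_succ C, cast_factorial_succ]
    field_simp
    ring

/-- The relation behind the invariance of Kummer's evaluation under lowering `b`. -/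
theorem ordinaryHypergeometric_kummer_lower {a b c : ℂ} (hab : c = 1 + a - (b + 1))
    (hC : ∀ m : ℕ, c ≠ -(m : ℂ)) {z : ℂ} (hz : ‖z‖ < 1) :
    c * ₂F₁ a (b + 1) c z = (a / 2 - b) * ₂F₁ a b (c + 1) z +
      a / 2 * (₂F₁ (a + 1) (b + 1) (c + 1) z + z * ₂F₁ (a + 1) (b + 1) (c + 1) z) := by
  refine ((hasSum_gaussCoeff a (b + 1) c hz).mul_left _).unique
    ((((hasSum_gaussCoeff a b (c + 1) hz).mul_left (a / 2 - b)).add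
    (((hasSum_gaussCoeff (a + 1) (b + 1) (c + 1) hz).add
    (hasSum_shift (hasSum_gaussCoeff (a + 1) (b + 1) (c + 1) hz))).mul_left
      (a / 2))).congr_forall fun k => ?_)
  have h0 : c ≠ 0 := by simpa using add_nat_ne_zero hC 0
  obtain _ | k := k
  · simp only [gaussCoeff_zero, if_true, hab]; ring
  · have hf : (k.factorial : ℂ) ≠ 0 := Nat.cast_ne_zero.2 k.factorial_ne_zero
    have hk : (k : ℂ) + 1 ≠ 0 := Nat.cast_add_one_ne_zero k
    have hv := poch_ne_zero_of_forall (add_one_ne_neg_nat hC) k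
    have hCk := add_nat_ne_zero (add_one_ne_neg_nat hC) k
    simp only [Nat.add_eq_zero_iff, one_ne_zero, and_false, if_false, Nat.add_sub_cancel,
      gaussCoeff, poch_succ_left a, poch_add_one_succ a, poch_succ_left b, poch_add_one_succ b,
      poch_succ_left c, poch_add_one_succ c, cast_factorial_succ]
    field_simp
    subst hab
    ring

/-- The relation behind the invariance of Kummer's evaluation under raising `a` by two. -/
theorem ordinaryHypergeometric_kummer_raise {a b c : ℂ} (hab : c = 1 + a - b)
    (hC : ∀ m : ℕ, c ≠ -(m : ℂ)) {z : ℂ} (hz : ‖z‖ < 1) :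
    c * (c + 1) * ₂F₁ a b c z = (2 + a - 2 * b) * (a + 1) * ₂F₁ (a + 2) b (c + 2) z +
      b * (b - 1) * (₂F₁ (a + 1) (b + 1) (c + 2) z + z * ₂F₁ (a + 1) (b + 1) (c + 2) z) := by
  refine ((hasSum_gaussCoeff a b c hz).mul_left _).unique
    ((((hasSum_gaussCoeff (a + 2) b (c + 2) hz).mul_left ((2 + a - 2 * b) * (a + 1))).add
    (((hasSum_gaussCoeff (a + 1) (b + 1) (c + 2) hz).add
    (hasSum_shift (hasSum_gaussCoeff (a + 1) (b + 1) (c + 2) hz))).mul_left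
      (b * (b - 1)))).congr_forall fun k => ?_)
  have h0 : c ≠ 0 := by simpa using add_nat_ne_zero hC 0
  have h1 : c + 1 ≠ 0 := by simpa using add_nat_ne_zero hC 1
  obtain _ | k := k
  · simp only [gaussCoeff_zero, if_true, hab]; ring
  · have hf : (k.factorial : ℂ) ≠ 0 := Nat.cast_ne_zero.2 k.factorial_ne_zero
    have hk : (k : ℂ) + 1 ≠ 0 := Nat.cast_add_one_ne_zero k
    have hv := poch_ne_zero_of_forall (add_one_ne_neg_nat hC) k
    have hCk := add_nat_ne_zero (add_one_ne_neg_nat hC) k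
    have hCk1 : c + 1 + (k + 1) ≠ 0 := by
      simpa using add_nat_ne_zero (add_one_ne_neg_nat hC) (k + 1)
    -- Since a + 1 may vanish, (a+2)_{k+1} cannot be obtained by dividing by it as is done for c;
    -- the factor a + 1 of the relation is absorbed instead.
    have ha : (a + 1) * poch (a + 2) (k + 1) = poch (a + 1) k * (a + 1 + k) * (a + 1 + (k + 1)) := by
      have := poch_succ_left (a + 1) (k + 1)
      rw [poch_succ, poch_succ, add_assoc a 1 1, one_add_one_eq_two] at this
      rw [← this]; push_cast; ring
    have hc : poch (c + 2) (k + 1) =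
        poch (c + 1) k * (c + 1 + k) * (c + 1 + (k + 1)) / (c + 1) := by
      rw [poch_add_two h1, poch_succ]; push_cast; ring
    have hL : (2 + a - 2 * b) * (a + 1) * gaussCoeff (a + 2) b (c + 2) (k + 1) =
        (2 + a - 2 * b) * (poch (a + 1) k * (a + 1 + k) * (a + 1 + (k + 1))) *
          (b * poch (b + 1) k) / (poch (c + 1) k * (c + 1 + k) * (c + 1 + (k + 1)) / (c + 1) *
            ((k + 1) * k.factorial)) := by
      rw [gaussCoeff, hc, ← ha, poch_succ_left b, cast_factorial_succ]
      ring
    rw [← mul_assoc _ (gaussCoeff (a + 2) b (c + 2) (k + 1)), hL]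
    simp only [Nat.add_eq_zero_iff, one_ne_zero, and_false, if_false, Nat.add_sub_cancel,
      gaussCoeff, hc]
    simp only [poch_succ_left a, poch_add_one_succ a, poch_succ_left b, poch_add_one_succ b,
      poch_succ_left c, poch_add_two h1, cast_factorial_succ]
    field_simp
    subst hab
    ring

/-! ### Existence of the continuation -/

theorem IsGaussContinuation.raise_second {A B C : ℂ} (hC : ∀ m : ℕ, C ≠ -(m : ℂ)) {F G : ℂ → ℂ}
    (hF : IsGaussContinuation A (B + 1) (C + 1) F)
    (hG : IsGaussContinuation (A + 1) (B + 1) (C + 2) G) :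
    IsGaussContinuation A B C
      fun z => F z - A * (C - B) / (C * (C + 1)) * (z * G z) := by
  refine ⟨hF.1.sub ((differentiableOn_id.mul hG.1).const_mul _), fun z hz => ?_⟩
  change F z - _ = _
  rw [hF.2 z hz, hG.2 z hz, ordinaryHypergeometric_raise_second hC hz]

theorem IsGaussContinuation.raise_third {A B C : ℂ} (hC : ∀ m : ℕ, C ≠ -(m : ℂ)) {F G : ℂ → ℂ}
    (hF : IsGaussContinuation A B (C + 1) F)
    (hG : IsGaussContinuation (A + 1) (B + 1) (C + 2) G) :
    IsGaussContinuation A B C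
      fun z => F z + A * B / (C * (C + 1)) * (z * G z) := by
  refine ⟨hF.1.add ((differentiableOn_id.mul hG.1).const_mul _), fun z hz => ?_⟩
  change F z + _ = _
  rw [hF.2 z hz, hG.2 z hz, ordinaryHypergeometric_raise_third hC hz]

/-- Both functions used by `raise_second` have B raised by one, while Re (C - B) stays the same or
grows; each use therefore extends the half-plane of admissible B by one unit. -/
theorem exists_isGaussContinuation_of_lt_re (p : ℕ) : ∀ {A B C : ℂ}, (∀ m : ℕ, C ≠ -(m : ℂ)) →
    -(p : ℝ) < B.re → 0 < (C - B).re → ∃ F, IsGaussContinuation A B C F := by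
  induction p with
  | zero =>
    intro A B C _ hB hCB
    exact ⟨_, isGaussContinuation_eulerIntegral (by simpa using hB) hCB⟩
  | succ p ih =>
    intro A B C hC hB hCB
    push_cast at hB
    have hB' : -(p : ℝ) < (B + 1).re := by rw [Complex.add_re, Complex.one_re]; linarith
    obtain ⟨F, hF⟩ := ih (A := A) (add_one_ne_neg_nat hC) hB' (by simpa using hCB)
    obtain ⟨G, hG⟩ := ih (A := A + 1) (add_two_ne_neg_nat hC) hB' (by
      simp only [Complex.sub_re, Complex.add_re, Complex.one_re, Complex.re_ofNat] at hCB ⊢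
      linarith)
    exact ⟨_, hF.raise_second hC hG⟩

/-- Both functions used by `raise_third` have C - B raised by one. Their B need not be controlled,
because the base case already allows every B. -/
theorem exists_isGaussContinuation_of_lt_re_sub (q : ℕ) : ∀ {A B C : ℂ},
    (∀ m : ℕ, C ≠ -(m : ℂ)) → -(q : ℝ) < (C - B).re → ∃ F, IsGaussContinuation A B C F := by
  induction q with
  | zero =>
    intro A B C hC hCB
    obtain ⟨p, hp⟩ := exists_nat_gt (-B.re)
    exact exists_isGaussContinuation_of_lt_re p hC (by linarith) (by simpa using hCB)
  | succ q ih =>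
    intro A B C hC hCB
    push_cast at hCB
    simp only [Complex.sub_re] at hCB
    obtain ⟨F, hF⟩ := ih (A := A) (B := B) (add_one_ne_neg_nat hC) (by
      simp only [Complex.sub_re, Complex.add_re, Complex.one_re]; linarith)
    obtain ⟨G, hG⟩ := ih (A := A + 1) (B := B + 1) (add_two_ne_neg_nat hC) (by
      simp only [Complex.sub_re, Complex.add_re, Complex.one_re, Complex.re_ofNat]; linarith)
    exact ⟨_, hF.raise_third hC hG⟩

theorem exists_isGaussContinuation {A B C : ℂ} (hC : ∀ m : ℕ, C ≠ -(m : ℂ)) :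
    ∃ F, IsGaussContinuation A B C F := by
  obtain ⟨q, hq⟩ := exists_nat_gt (-(C - B).re)
  exact exists_isGaussContinuation_of_lt_re_sub q hC (by linarith)

theorem isGaussContinuation_gauss2F1 {A B C : ℂ} (hC : ∀ m : ℕ, C ≠ -(m : ℂ)) :
    IsGaussContinuation A B C (gauss2F1 A B C) :=
  Classical.epsilon_spec (exists_isGaussContinuation hC)

/-! ### Contiguous relations at `-1` -/

theorem differentiableOn_gauss2F1 {A B C : ℂ} (hC : ∀ m : ℕ, C ≠ -(m : ℂ)) :
    DifferentiableOn ℂ (gauss2F1 A B C) cutPlane := (isGaussContinuation_gauss2F1 hC).1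

theorem gauss2F1_of_norm_lt_one {A B C : ℂ} (hC : ∀ m : ℕ, C ≠ -(m : ℂ)) {z : ℂ} (hz : ‖z‖ < 1) :
    gauss2F1 A B C z = ₂F₁ A B C z := (isGaussContinuation_gauss2F1 hC).2 z hz

theorem gauss2F1_raise_first {A B C : ℂ} (hC : ∀ m : ℕ, C ≠ -(m : ℂ)) :
    gauss2F1 (A + 1) B C (-1) =
      gauss2F1 A B C (-1) - B / C * gauss2F1 (A + 1) (B + 1) (C + 1) (-1) := by
  have hC1 := add_one_ne_neg_nat hC
  have h := eq_zero_of_forall_norm_lt_one (G := fun z => gauss2F1 (A + 1) B C z -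
    (gauss2F1 A B C z + B / C * (z * gauss2F1 (A + 1) (B + 1) (C + 1) z)))
    ((differentiableOn_gauss2F1 hC).sub ((differentiableOn_gauss2F1 hC).add
      ((differentiableOn_id.mul (differentiableOn_gauss2F1 hC1)).const_mul _)))
    (fun z hz => by
      rw [gauss2F1_of_norm_lt_one hC hz, gauss2F1_of_norm_lt_one hC hz,
        gauss2F1_of_norm_lt_one hC1 hz, ordinaryHypergeometric_raise_first hC hz, sub_self])
    neg_one_mem_cutPlane
  linear_combination h

theorem gauss2F1_lower_first_raise_second {A B C : ℂ} (hC : ∀ m : ℕ, C ≠ -(m : ℂ)) :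
    (C - (A + 1) - B) * gauss2F1 (A + 1) B C (-1) =
      (C - (A + 1)) * gauss2F1 A B C (-1) - 2 * B * gauss2F1 (A + 1) (B + 1) C (-1) := by
  have h := eq_zero_of_forall_norm_lt_one (G := fun z => (C - (A + 1) - B) * gauss2F1 (A + 1) B C z -
    ((C - (A + 1)) * gauss2F1 A B C z +
      B * (z * gauss2F1 (A + 1) (B + 1) C z) - B * gauss2F1 (A + 1) (B + 1) C z))
    (((differentiableOn_gauss2F1 hC).const_mul _).sub
      ((((differentiableOn_gauss2F1 hC).const_mul _).add
      ((differentiableOn_id.mul (differentiableOn_gauss2F1 hC)).const_mul _)).sub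
      ((differentiableOn_gauss2F1 hC).const_mul _)))
    (fun z hz => by
      simp only [gauss2F1_of_norm_lt_one hC hz]
      rw [ordinaryHypergeometric_lower_first_raise_second hC hz, sub_self])
    neg_one_mem_cutPlane
  linear_combination h

/-- The third function of the relation carries the factor 1 + z, so only two terms survive at -1. -/
theorem gauss2F1_kummer_lower {a b c : ℂ} (hab : c = 1 + a - (b + 1))
    (hC : ∀ m : ℕ, c ≠ -(m : ℂ)) :
    c * gauss2F1 a (b + 1) c (-1) = (a / 2 - b) * gauss2F1 a b (c + 1) (-1) := by
  have hC1 := add_one_ne_neg_nat hC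
  have h := eq_zero_of_forall_norm_lt_one (G := fun z => c * gauss2F1 a (b + 1) c z -
    ((a / 2 - b) * gauss2F1 a b (c + 1) z +
      a / 2 * (gauss2F1 (a + 1) (b + 1) (c + 1) z + z * gauss2F1 (a + 1) (b + 1) (c + 1) z)))
    (((differentiableOn_gauss2F1 hC).const_mul _).sub
      (((differentiableOn_gauss2F1 hC1).const_mul _).add
      (((differentiableOn_gauss2F1 hC1).add
        (differentiableOn_id.mul (differentiableOn_gauss2F1 hC1))).const_mul _)))
    (fun z hz => by
      simp only [gauss2F1_of_norm_lt_one hC hz, gauss2F1_of_norm_lt_one hC1 hz]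
      rw [ordinaryHypergeometric_kummer_lower hab hC hz, sub_self])
    neg_one_mem_cutPlane
  linear_combination h

theorem gauss2F1_kummer_raise {a b c : ℂ} (hab : c = 1 + a - b)
    (hC : ∀ m : ℕ, c ≠ -(m : ℂ)) :
    c * (c + 1) * gauss2F1 a b c (-1) =
      (2 + a - 2 * b) * (a + 1) * gauss2F1 (a + 2) b (c + 2) (-1) := by
  have hC2 := add_two_ne_neg_nat hC
  have h := eq_zero_of_forall_norm_lt_one (G := fun z => c * (c + 1) * gauss2F1 a b c z -
    ((2 + a - 2 * b) * (a + 1) * gauss2F1 (a + 2) b (c + 2) z +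
      b * (b - 1) * (gauss2F1 (a + 1) (b + 1) (c + 2) z + z * gauss2F1 (a + 1) (b + 1) (c + 2) z)))
    (((differentiableOn_gauss2F1 hC).const_mul _).sub
      (((differentiableOn_gauss2F1 hC2).const_mul _).add
      (((differentiableOn_gauss2F1 hC2).add
        (differentiableOn_id.mul (differentiableOn_gauss2F1 hC2))).const_mul _)))
    (fun z hz => by
      simp only [gauss2F1_of_norm_lt_one hC hz, gauss2F1_of_norm_lt_one hC2 hz]
      rw [ordinaryHypergeometric_kummer_raise hab hC hz, sub_self])
    neg_one_mem_cutPlane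
  linear_combination h


/-! ### Kummer's theorem -/

/-- At z = -1 the Euler integrand is t^(a-1) (1-t)^(-b) (1+t)^(-b) = t^(a-1) (1-t²)^(-b); substitute
x = t². -/
theorem betaIntegral_half_eq (a b : ℂ) :
    Complex.betaIntegral (a / 2) (1 - b) = 2 * eulerIntegral b a (1 + a - b) (-1) := by
  have himage : (fun t : ℝ => t ^ 2) '' Set.Ioo 0 1 = Set.Ioo 0 1 := by
    ext x
    constructor
    · rintro ⟨t, ht, rfl⟩
      exact ⟨pow_pos ht.1 2, pow_lt_one₀ ht.1.le ht.2 two_ne_zero⟩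
    · rintro ⟨h0, h1⟩
      exact ⟨√x, ⟨Real.sqrt_pos.2 h0, by rw [Real.sqrt_lt' one_pos]; simpa using h1⟩,
        Real.sq_sqrt h0.le⟩
  have hderiv : ∀ t ∈ Set.Ioo (0 : ℝ) 1,
      HasDerivWithinAt (fun t : ℝ => t ^ 2) (2 * t) (Set.Ioo 0 1) t := fun t _ => by
    simpa using (hasDerivAt_pow 2 t).hasDerivWithinAt
  have hinj : Set.InjOn (fun t : ℝ => t ^ 2) (Set.Ioo 0 1) := fun x hx y hy h =>
    (pow_left_inj₀ hx.1.le hy.1.le two_ne_zero).1 h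
  have key := integral_image_eq_integral_abs_deriv_smul measurableSet_Ioo hderiv hinj
    (fun x : ℝ => (x : ℂ) ^ (a / 2 - 1) * (1 - (x : ℂ)) ^ (1 - b - 1))
  rw [himage] at key
  rw [Complex.betaIntegral, eulerIntegral, ← intervalIntegral.integral_const_mul,
    intervalIntegral.integral_of_le zero_le_one, intervalIntegral.integral_of_le zero_le_one,
    integral_Ioc_eq_integral_Ioo, integral_Ioc_eq_integral_Ioo, key]
  refine setIntegral_congr_fun measurableSet_Ioo fun t ht => ?_
  have ht0 : (t : ℂ) ≠ 0 := Complex.ofReal_ne_zero.2 ht.1.ne'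
  have h1 : ((t ^ 2 : ℝ) : ℂ) ^ (a / 2 - 1) * t = (t : ℂ) ^ (a - 1) := by
    rw [sq, Complex.ofReal_mul, Complex.mul_cpow_ofReal_nonneg ht.1.le ht.1.le,
      ← Complex.cpow_add _ _ ht0]
    nth_rewrite 2 [← Complex.cpow_one (t : ℂ)]
    rw [← Complex.cpow_add _ _ ht0]
    congr 1
    ring
  have h2 : (1 - ((t ^ 2 : ℝ) : ℂ)) ^ (1 - b - 1) =
      (1 - (t : ℂ)) ^ (1 - b - 1) * (1 - -1 * (t : ℂ)) ^ (-b) := by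
    have hb : 1 - b - 1 = -b := by ring
    have h3 : (1 - ((t ^ 2 : ℝ) : ℂ)) = ((1 - t : ℝ) : ℂ) * ((1 + t : ℝ) : ℂ) := by
      push_cast; ring
    rw [h3, hb, Complex.mul_cpow_ofReal_nonneg (by linarith [ht.2]) (by linarith [ht.1])]
    push_cast
    ring_nf
  have hC : 1 + a - b - a = 1 - b := by ring
  rw [h2, betaWeight, hC, ← h1, abs_of_pos (by linarith [ht.1]), Complex.real_smul]
  push_cast
  ring

/-- The value of Kummer's series `₂F₁(a, b; 1 + a - b; -1)`, in a form without poles in `a`. -/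
def kummerValue (a b : ℂ) : ℂ :=
  (√Real.pi : ℂ) * 2 ^ (-a) * Complex.Gamma (1 + a - b) *
    ((Complex.Gamma ((1 + a) / 2))⁻¹ * (Complex.Gamma (1 + a / 2 - b))⁻¹)

theorem sqrt_pi_ne_zero : (√Real.pi : ℂ) ≠ 0 :=
  Complex.ofReal_ne_zero.2 (Real.sqrt_pos.2 Real.pi_pos).ne'

theorem gauss2F1_comm {A B C : ℂ} (hC : ∀ m : ℕ, C ≠ -(m : ℂ)) {z : ℂ} (hz : z ∈ cutPlane) :
    gauss2F1 A B C z = gauss2F1 B A C z := by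
  refine (isGaussContinuation_gauss2F1 hC).eq
    ⟨(isGaussContinuation_gauss2F1 hC).1, fun w hw => ?_⟩ hz
  rw [(isGaussContinuation_gauss2F1 hC).2 w hw, ordinaryHypergeometric, ordinaryHypergeometric,
    ordinaryHypergeometricSeries_symm]

theorem kummer_of_re {a b : ℂ} (ha : 0 < a.re) (hb : b.re < 1) :
    gauss2F1 a b (1 + a - b) (-1) = kummerValue a b := by
  have hb' : 0 < (1 - b).re := by simpa using hb
  have hC : 1 + a - b - a = 1 - b := by ring
  have hCre : 0 < (1 + a - b).re := by
    simp only [Complex.sub_re, Complex.add_re, Complex.one_re]; linarith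
  have ha2 : 0 < (a / 2).re := by simpa using ha
  have hE := isGaussContinuation_eulerIntegral (A := b) (B := a) (C := 1 + a - b) ha
    (by rwa [hC])
  have hCn := ne_neg_nat_of_re_pos hCre
  -- With the upper parameters exchanged, Euler's integral has weight exponents a - 1 and -b, and
  -- converges exactly under the two hypotheses.
  rw [gauss2F1_comm hCn neg_one_mem_cutPlane,
    (isGaussContinuation_gauss2F1 hCn).eq hE neg_one_mem_cutPlane, hC]
  have h1 := betaIntegral_half_eq a b
  have hab : a + (1 - b) = 1 + a - b := by ring
  have hab2 : a / 2 + (1 - b) = 1 + a / 2 - b := by ring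
  rw [Complex.betaIntegral_eq_Gamma_mul_div _ _ ha2 hb', hab2] at h1
  rw [Complex.betaIntegral_eq_Gamma_mul_div _ _ ha hb', hab, kummerValue]
  have hdup := Complex.Gamma_mul_Gamma_add_half (a / 2)
  rw [show 2 * (a / 2) = a by ring, show a / 2 + 1 / 2 = (1 + a) / 2 by ring,
    Complex.cpow_sub _ _ two_ne_zero, Complex.cpow_one] at hdup
  rw [Complex.cpow_neg]
  have h2a : (2 : ℂ) ^ a ≠ 0 := by simp [Complex.cpow_eq_zero_iff]
  have g1 := Complex.Gamma_ne_zero_of_re_pos ha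
  have g2 := Complex.Gamma_ne_zero_of_re_pos hb'
  have g3 := Complex.Gamma_ne_zero_of_re_pos hCre
  have g4 : Complex.Gamma ((1 + a) / 2) ≠ 0 := Complex.Gamma_ne_zero_of_re_pos (by
    simp only [Complex.div_ofNat_re, Complex.add_re, Complex.one_re]; linarith)
  have g5 : Complex.Gamma (1 + a / 2 - b) ≠ 0 := Complex.Gamma_ne_zero_of_re_pos (by
    simp only [Complex.div_ofNat_re, Complex.add_re, Complex.one_re, Complex.sub_re]; linarith)
  rw [show eulerIntegral b a (1 + a - b) (-1) =
    Complex.Gamma (a / 2) * Complex.Gamma (1 - b) / Complex.Gamma (1 + a / 2 - b) / 2 by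
      rw [h1]; ring]
  generalize Complex.Gamma (1 + a / 2 - b) = G at g5 ⊢
  field_simp at hdup ⊢
  linear_combination hdup

theorem inv_Gamma_eq (s : ℂ) :
    (Complex.Gamma s)⁻¹ = s * (Complex.Gamma (s + 1))⁻¹ :=
  Complex.one_div_Gamma_eq_self_mul_one_div_Gamma_add_one s

/-- The closed form obeys the same two-term relation as the Gauss function at -1. Reciprocal Gamma
factors keep it valid also where a/2 - b is a pole of Γ. -/
theorem kummerValue_lower {a b : ℂ} (h : a - b ≠ 0) :
    (a - b) * kummerValue a (b + 1) = (a / 2 - b) * kummerValue a b := by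
  rw [kummerValue, kummerValue, show 1 + a - (b + 1) = a - b by ring,
    show 1 + a / 2 - (b + 1) = a / 2 - b by ring, inv_Gamma_eq (a / 2 - b),
    show 1 + a - b = a - b + 1 by ring, Complex.Gamma_add_one _ h,
    show a / 2 - b + 1 = 1 + a / 2 - b by ring]
  ring

theorem kummerValue_raise {a b : ℂ} (h1 : 1 + a - b ≠ 0) (h2 : 1 + a - b + 1 ≠ 0) :
    (1 + a - b) * (1 + a - b + 1) * kummerValue a b =
      (2 + a - 2 * b) * (a + 1) * kummerValue (a + 2) b := by
  rw [kummerValue, kummerValue, inv_Gamma_eq ((1 + a) / 2), inv_Gamma_eq (1 + a / 2 - b),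
    show 1 + (a + 2) - b = 1 + a - b + 1 + 1 by ring, Complex.Gamma_add_one _ h2,
    Complex.Gamma_add_one _ h1, show (1 + (a + 2)) / 2 = (1 + a) / 2 + 1 by ring,
    show 1 + (a + 2) / 2 - b = 1 + a / 2 - b + 1 by ring, neg_add, Complex.cpow_add _ _ two_ne_zero,
    Complex.cpow_neg _ 2, Complex.cpow_ofNat]
  ring

/-- The relation moves a by two at fixed b, hence the two-step induction over half-planes of a. -/
theorem kummer_of_re_lt_one (p : ℕ) : ∀ {a b : ℂ}, -(p : ℝ) < a.re → b.re < 1 →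
    (∀ m : ℕ, 1 + a - b ≠ -(m : ℂ)) → gauss2F1 a b (1 + a - b) (-1) = kummerValue a b := by
  induction p using Nat.twoStepInduction with
  | zero => exact fun ha hb _ => kummer_of_re (by simpa using ha) hb
  | one =>
    intro a b ha hb hC
    have h0 : 1 + a - b ≠ 0 := by simpa using add_nat_ne_zero hC 0
    have h1 : 1 + a - b + 1 ≠ 0 := by simpa using add_nat_ne_zero hC 1
    refine mul_left_cancel₀ (mul_ne_zero h0 h1) ?_
    rw [gauss2F1_kummer_raise rfl hC, kummerValue_raise h0 h1,
      show 1 + a - b + 2 = 1 + (a + 2) - b by ring, kummer_of_re (a := a + 2) (b := b) ?_ hb]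
    simp only [Nat.cast_one] at ha
    rw [Complex.add_re, Complex.re_ofNat]; linarith
  | more p ih _ =>
    intro a b ha hb hC
    have h0 : 1 + a - b ≠ 0 := by simpa using add_nat_ne_zero hC 0
    have h1 : 1 + a - b + 1 ≠ 0 := by simpa using add_nat_ne_zero hC 1
    refine mul_left_cancel₀ (mul_ne_zero h0 h1) ?_
    have hC2 := add_two_ne_neg_nat hC
    rw [gauss2F1_kummer_raise rfl hC, kummerValue_raise h0 h1]
    rw [show 1 + a - b + 2 = 1 + (a + 2) - b by ring] at hC2 ⊢
    rw [ih (a := a + 2) (b := b) ?_ hb hC2]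
    push_cast at ha
    rw [Complex.add_re, Complex.re_ofNat]; linarith

theorem kummer_of_re_lt (q : ℕ) : ∀ {a b : ℂ}, b.re < q + 1 →
    (∀ m : ℕ, 1 + a - b ≠ -(m : ℂ)) → gauss2F1 a b (1 + a - b) (-1) = kummerValue a b := by
  induction q with
  | zero =>
    intro a b hb hC
    obtain ⟨p, hp⟩ := exists_nat_gt (-a.re)
    exact kummer_of_re_lt_one p (by linarith) (by simpa using hb) hC
  | succ q ih =>
    intro a b hb hC
    obtain ⟨b, rfl⟩ : ∃ b', b = b' + 1 := ⟨b - 1, by ring⟩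
    have hab : 1 + a - (b + 1) = a - b := by ring
    have h0 : a - b ≠ 0 := by simpa [hab] using hC 0
    refine mul_left_cancel₀ h0 ?_
    have hC1 := add_one_ne_neg_nat hC
    rw [kummerValue_lower h0]
    rw [← hab, gauss2F1_kummer_lower rfl hC]
    rw [show 1 + a - (b + 1) + 1 = 1 + a - b by ring] at hC1 ⊢
    rw [ih ?_ hC1]
    push_cast at hb
    rw [Complex.add_re, Complex.one_re] at hb
    linarith

/-- **Kummer's theorem.** -/
theorem gauss2F1_kummer {a b : ℂ} (hC : ∀ m : ℕ, 1 + a - b ≠ -(m : ℂ)) :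
    gauss2F1 a b (1 + a - b) (-1) = kummerValue a b := by
  obtain ⟨q, hq⟩ := exists_nat_gt b.re
  exact kummer_of_re_lt q (by linarith) hC


/-! ### The Gamma terms -/

/-- `gammaTermP`, in a form without poles in `a`. -/
def regularTermP (a b : ℂ) : ℂ :=
  2 * (√Real.pi : ℂ) * 2 ^ (-a) * Complex.Gamma (a - b) *
    ((Complex.Gamma (a / 2))⁻¹ * (Complex.Gamma ((a + 1) / 2 - b))⁻¹)

/-- `gammaTermQ`, in a form without poles in `a`. -/
def regularTermQ (a b : ℂ) : ℂ :=
  2 * (√Real.pi : ℂ) * 2 ^ (-a) * Complex.Gamma (a - b) *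
    ((Complex.Gamma ((a + 1) / 2))⁻¹ * (Complex.Gamma (a / 2 - b))⁻¹)

/-- The poles of Γ, where its assigned value is 0, are zeros of the entire function 1/Γ. This is not
identically zero, so its zeros are isolated. -/
theorem eventually_Gamma_ne_zero (a : ℂ) : ∀ᶠ z in 𝓝[≠] a, Complex.Gamma z ≠ 0 := by
  have hA : AnalyticOnNhd ℂ (fun s : ℂ => (Complex.Gamma s)⁻¹) Set.univ :=
    Complex.differentiable_one_div_Gamma.differentiableOn.analyticOnNhd isOpen_univ
  rcases (hA a trivial).eventually_eq_zero_or_eventually_ne_zero with h | h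
  · have h1 := hA.eqOn_zero_of_preconnected_of_eventuallyEq_zero isPreconnected_univ trivial h
      (Set.mem_univ (1 : ℂ))
    simp at h1
  · exact h.mono fun z hz => inv_eq_zero.not.1 hz

theorem Gamma_half_mul_Gamma (z : ℂ) :
    Complex.Gamma (z / 2) * Complex.Gamma ((z + 1) / 2) =
      Complex.Gamma z * (2 * 2 ^ (-z)) * (√Real.pi : ℂ) := by
  have h := Complex.Gamma_mul_Gamma_add_half (z / 2)
  rwa [show 2 * (z / 2) = z by ring, show z / 2 + 1 / 2 = (z + 1) / 2 by ring, sub_eq_add_neg,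
    Complex.cpow_add _ _ two_ne_zero, Complex.cpow_one] at h

theorem Gamma_half_ne_zero {z : ℂ} (hz : Complex.Gamma z ≠ 0) :
    Complex.Gamma (z / 2) ≠ 0 ∧ Complex.Gamma ((z + 1) / 2) ≠ 0 := by
  rw [← mul_ne_zero_iff, Gamma_half_mul_Gamma]
  exact mul_ne_zero (mul_ne_zero hz (mul_ne_zero two_ne_zero (by simp [Complex.cpow_eq_zero_iff])))
    sqrt_pi_ne_zero

theorem continuous_inv_Gamma : Continuous fun s : ℂ => (Complex.Gamma s)⁻¹ :=
  Complex.differentiable_one_div_Gamma.continuous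

theorem continuousAt_Gamma_sub {a b : ℂ} (hab : ∀ m : ℕ, a - b ≠ -(m : ℂ)) :
    ContinuousAt (fun z => Complex.Gamma (z - b)) a :=
  (Complex.differentiableAt_Gamma (a - b) hab).continuousAt.comp (f := fun z => z - b)
    (by fun_prop)

theorem continuousAt_regularTermP {a b : ℂ} (hab : ∀ m : ℕ, a - b ≠ -(m : ℂ)) :
    ContinuousAt (fun z => regularTermP z b) a := by
  have h1 : Continuous fun z : ℂ => (Complex.Gamma (z / 2))⁻¹ :=
    continuous_inv_Gamma.comp (by fun_prop)
  have h2 : Continuous fun z : ℂ => (Complex.Gamma ((z + 1) / 2 - b))⁻¹ :=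
    continuous_inv_Gamma.comp (by fun_prop)
  have h3 : Continuous fun z : ℂ => (2 : ℂ) ^ (-z) :=
    continuous_neg.const_cpow (Or.inl two_ne_zero)
  exact ((h3.continuousAt.const_mul _).mul (continuousAt_Gamma_sub hab)).mul
    (h1.mul h2).continuousAt

theorem continuousAt_regularTermQ {a b : ℂ} (hab : ∀ m : ℕ, a - b ≠ -(m : ℂ)) :
    ContinuousAt (fun z => regularTermQ z b) a := by
  have h1 : Continuous fun z : ℂ => (Complex.Gamma ((z + 1) / 2))⁻¹ :=
    continuous_inv_Gamma.comp (by fun_prop)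
  have h2 : Continuous fun z : ℂ => (Complex.Gamma (z / 2 - b))⁻¹ :=
    continuous_inv_Gamma.comp (by fun_prop)
  have h3 : Continuous fun z : ℂ => (2 : ℂ) ^ (-z) :=
    continuous_neg.const_cpow (Or.inl two_ne_zero)
  exact ((h3.continuousAt.const_mul _).mul (continuousAt_Gamma_sub hab)).mul
    (h1.mul h2).continuousAt

/-- Duplication replaces Γ((z+1)/2)/Γ(z) by a multiple of 1/Γ(z/2) off the poles of Γ(z); the limit
is then the value at a by continuity. -/
theorem gammaTermP_eq {a b : ℂ} (hab : ∀ m : ℕ, a - b ≠ -(m : ℂ)) :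
    gammaTermP a b = regularTermP a b := by
  refine Filter.Tendsto.limUnder_eq (((continuousAt_regularTermP hab).tendsto.mono_left
    nhdsWithin_le_nhds).congr' ?_)
  filter_upwards [eventually_Gamma_ne_zero a] with z hz
  obtain ⟨h1, h2⟩ := Gamma_half_ne_zero hz
  have h3 : Complex.Gamma ((z + 1) / 2) / Complex.Gamma z =
      2 * (√Real.pi : ℂ) * 2 ^ (-z) * (Complex.Gamma (z / 2))⁻¹ := by
    rw [← div_eq_mul_inv, div_eq_div_iff hz h1]
    linear_combination Gamma_half_mul_Gamma z
  rw [regularTermP]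
  linear_combination
    -(Complex.Gamma (z - b) * (Complex.Gamma ((z + 1) / 2 - b))⁻¹) * h3

theorem gammaTermQ_eq {a b : ℂ} (hab : ∀ m : ℕ, a - b ≠ -(m : ℂ)) :
    gammaTermQ a b = regularTermQ a b := by
  refine Filter.Tendsto.limUnder_eq (((continuousAt_regularTermQ hab).tendsto.mono_left
    nhdsWithin_le_nhds).congr' ?_)
  filter_upwards [eventually_Gamma_ne_zero a] with z hz
  obtain ⟨h1, h2⟩ := Gamma_half_ne_zero hz
  have h3 : Complex.Gamma (z / 2) / Complex.Gamma z =
      2 * (√Real.pi : ℂ) * 2 ^ (-z) * (Complex.Gamma ((z + 1) / 2))⁻¹ := by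
    rw [← div_eq_mul_inv, div_eq_div_iff hz h2]
    linear_combination Gamma_half_mul_Gamma z
  rw [regularTermQ]
  linear_combination -(Complex.Gamma (z - b) * (Complex.Gamma (z / 2 - b))⁻¹) * h3

theorem kummerValue_eq_regularTermP (a b : ℂ) : kummerValue (a - 1) b = regularTermP a b := by
  rw [kummerValue, regularTermP, show -(a - 1) = 1 + -a by ring, Complex.cpow_add _ _ two_ne_zero,
    Complex.cpow_one, show 1 + (a - 1) = a by ring, show 1 + (a - 1) / 2 - b = (a + 1) / 2 - b by ring]
  ring

theorem kummerValue_eq_regularTermQ (a b : ℂ) : kummerValue a (b + 1) = regularTermQ a b / 2 := by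
  rw [kummerValue, regularTermQ, show 1 + a - (b + 1) = a - b by ring,
    show 1 + a / 2 - (b + 1) = a / 2 - b by ring, add_comm 1 a]
  ring

/-- The factor a - b cancels the denominator in `gauss2F1_shift`, leaving the b/(2a) of `P_add_two`.
-/
theorem regularTermP_shift {a b : ℂ} (ha : a ≠ 0) (hab : a - b ≠ 0) :
    regularTermP (a + 2) (b + 1) = (a - b) / (2 * a) * regularTermP a b := by
  rw [regularTermP, regularTermP, inv_Gamma_eq (a / 2), show a + 2 - (b + 1) = a - b + 1 by ring,
    Complex.Gamma_add_one _ hab, show (a + 2) / 2 = a / 2 + 1 by ring,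
    show (a + 2 + 1) / 2 - (b + 1) = (a + 1) / 2 - b by ring, neg_add,
    Complex.cpow_add _ _ two_ne_zero, Complex.cpow_neg _ 2, Complex.cpow_ofNat]
  field_simp

theorem regularTermQ_shift {a b : ℂ} (ha : a + 1 ≠ 0) (hab : a - b ≠ 0) :
    regularTermQ (a + 2) (b + 1) = (a - b) / (2 * (a + 1)) * regularTermQ a b := by
  rw [regularTermQ, regularTermQ, inv_Gamma_eq ((a + 1) / 2),
    show a + 2 - (b + 1) = a - b + 1 by ring,
    Complex.Gamma_add_one _ hab, show (a + 2 + 1) / 2 = (a + 1) / 2 + 1 by ring,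
    show (a + 2) / 2 - (b + 1) = a / 2 - b by ring, neg_add,
    Complex.cpow_add _ _ two_ne_zero, Complex.cpow_neg _ 2, Complex.cpow_ofNat]
  field_simp

/-! ### The first values -/

theorem gauss2F1_pred {a b : ℂ} (hab : ∀ m : ℕ, a - b ≠ -(m : ℂ)) :
    gauss2F1 (a - 1) b (a - b) (-1) = regularTermP a b := by
  have h : 1 + (a - 1) - b = a - b := by ring
  rw [← kummerValue_eq_regularTermP, ← gauss2F1_kummer (by rwa [h]), h]

theorem gauss2F1_raise_second {a b : ℂ} (hab : ∀ m : ℕ, a - b ≠ -(m : ℂ)) :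
    gauss2F1 a (b + 1) (a - b) (-1) = regularTermQ a b / 2 := by
  have h : 1 + a - (b + 1) = a - b := by ring
  rw [← kummerValue_eq_regularTermQ, ← gauss2F1_kummer (by rwa [h]), h]

theorem isGaussContinuation_zero (A C : ℂ) : IsGaussContinuation A 0 C fun _ => 1 := by
  refine ⟨differentiableOn_const _, fun z hz => ?_⟩
  refine (HasSum.unique (hasSum_gaussCoeff A 0 C hz) ?_).symm
  convert hasSum_single (f := fun k => gaussCoeff A 0 C k * z ^ k) 0 fun k hk => ?_ using 1
  · simp [gaussCoeff_zero]
  · obtain ⟨k, rfl⟩ := Nat.exists_eq_succ_of_ne_zero hk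
    simp [gaussCoeff, poch_succ_left]

theorem gauss2F1_self {a b : ℂ} (hab : ∀ m : ℕ, a - b ≠ -(m : ℂ)) :
    gauss2F1 a b (a - b) (-1) = 1 / 2 * regularTermP a b + 1 / 2 * regularTermQ a b := by
  -- The contiguous relation used for b ≠ 0 has the common factor b. At b = 0 it is void, but there
  -- the Gauss function is constantly 1 and the two Gamma terms coincide.
  by_cases hb : b = 0
  · subst hb
    have h1 := (isGaussContinuation_gauss2F1 hab).eq (isGaussContinuation_zero a _)
      neg_one_mem_cutPlane
    have h2 := (gauss2F1_pred hab).symm.trans ((isGaussContinuation_gauss2F1 hab).eq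
      (isGaussContinuation_zero (a - 1) _) neg_one_mem_cutPlane)
    have h3 : regularTermQ a 0 = regularTermP a 0 := by
      rw [regularTermQ, regularTermP, sub_zero, sub_zero]; ring_nf
    rw [h1, h3, h2]
    norm_num
  · have h := gauss2F1_lower_first_raise_second (A := a - 1) (B := b) hab
    rw [show a - 1 + 1 = a by ring, gauss2F1_pred hab, gauss2F1_raise_second hab] at h
    refine mul_left_cancel₀ (mul_ne_zero two_ne_zero hb) ?_
    linear_combination -h

theorem gauss2F1_shift (n : ℕ) {a b : ℂ} (hab : ∀ m : ℕ, a - b ≠ -(m : ℂ)) :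
    gauss2F1 (a + (n + 2 : ℕ)) b (a - b) (-1) = gauss2F1 (a + (n + 1 : ℕ)) b (a - b) (-1) -
      b / (a - b) * gauss2F1 (a + 2 + n) (b + 1) (a + 2 - (b + 1)) (-1) := by
  have h := gauss2F1_raise_first (A := a + (n + 1 : ℕ)) (B := b) hab
  rw [show a + 2 + (n : ℂ) = a + (n + 1 : ℕ) + 1 by push_cast; ring,
    show a + 2 - (b + 1) = a - b + 1 by ring, ← h,
    show a + ((n + 2 : ℕ) : ℂ) = a + (n + 1 : ℕ) + 1 by push_cast; ring]

theorem gauss2F1_one {a b : ℂ} (ha : a ≠ 0) (hab : ∀ m : ℕ, a - b ≠ -(m : ℂ)) :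
    gauss2F1 (a + 1) b (a - b) (-1) =
      (1 / 2 - b / (2 * a)) * regularTermP a b + 1 / 2 * regularTermQ a b := by
  have h0 : a - b ≠ 0 := by simpa using hab 0
  have hab' : ∀ m : ℕ, a + 2 - (b + 1) ≠ -(m : ℂ) := fun m => by
    have := add_one_ne_neg_nat hab m
    rwa [show a - b + 1 = a + 2 - (b + 1) by ring] at this
  have h := gauss2F1_pred hab'
  rw [show a + 2 - 1 = a + 1 by ring, show a + 2 - (b + 1) = a - b + 1 by ring] at h
  rw [gauss2F1_raise_first hab, gauss2F1_self hab, h, regularTermP_shift ha h0]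
  field_simp
  ring


/-! ### The recurrences of the coefficients -/

/-- The sum of the terms of index at most `N` with coefficients `c k * (b)_k / (d)_k`. -/
def pochSum (N : ℕ) (c : ℕ → ℂ) (b d : ℂ) : ℂ :=
  ∑ k ∈ Finset.range (N + 1), c k * (poch b k / poch d k)

theorem pochSum_succ {c₀ c₁ c₂ : ℕ → ℂ} {M : ℕ} (h0 : c₂ 0 = c₁ 0)
    (h : ∀ k ≤ M, c₂ (k + 1) = c₁ (k + 1) - c₀ k / 4) (b d : ℂ) :
    pochSum (M + 1) c₂ b d =
      pochSum (M + 1) c₁ b d - b / (4 * d) * pochSum M c₀ (b + 1) (d + 1) := by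
  rw [pochSum, pochSum, pochSum, Finset.sum_range_succ', Finset.sum_range_succ' _ (M + 1),
    Finset.mul_sum, h0, add_sub_right_comm, ← Finset.sum_sub_distrib]
  refine congrArg (· + _) (Finset.sum_congr rfl fun k hk => ?_)
  rw [h k (Nat.lt_succ_iff.1 (Finset.mem_range.1 hk)), poch_succ_left b, poch_succ_left d,
    mul_div_mul_comm, mul_comm 4 d, ← div_div]
  ring

theorem pochSum_extend {c : ℕ → ℂ} {N N' : ℕ} (hN : N ≤ N') (h : ∀ k, N < k → c k = 0)
    (b d : ℂ) : pochSum N c b d = pochSum N' c b d := by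
  refine Finset.sum_subset (Finset.range_mono (by omega)) fun k _ hk => ?_
  rw [h k (by simpa using hk), zero_mul]

/-- The coefficients `(x/2)_k ((x-1)/2)_k / ((x)_k k!)`. -/
def lucasCoeff (x : ℂ) (k : ℕ) : ℂ :=
  poch (x / 2) k * poch ((x - 1) / 2) k / (poch x k * k.factorial)

/-- The coefficients `((x+1)/2)_k (x/2)_k / ((x)_k k!)`. -/
def fibCoeff (x : ℂ) (k : ℕ) : ℂ :=
  poch ((x + 1) / 2) k * poch (x / 2) k / (poch x k * k.factorial)

theorem P_eq (n : ℕ) (a b : ℂ) :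
    P n a b = 1 / 2 * pochSum ((n + 1) / 2) (lucasCoeff (-n)) b (a / 2) := by
  rw [P, terminating3F2, pochSum]
  refine congrArg _ (Finset.sum_congr rfl fun k _ => ?_)
  rw [lucasCoeff, show (-(n : ℂ) - 1) / 2 = -((n : ℂ) + 1) / 2 by ring, div_mul_div_comm]
  ring

theorem Q_eq (n : ℕ) (a b : ℂ) :
    Q n a b = 1 / 2 * pochSum (n / 2) (fibCoeff (-n)) b ((a + 1) / 2) := by
  rw [Q, terminating3F2, pochSum]
  refine congrArg _ (Finset.sum_congr rfl fun k _ => ?_)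
  rw [fibCoeff, show (-(n : ℂ) + 1) / 2 = -((n : ℂ) - 1) / 2 by ring, div_mul_div_comm]
  ring

theorem poch_neg_nat_eq_zero {m k : ℕ} (h : m < k) : poch (-(m : ℂ)) k = 0 :=
  (ascPochhammer_eval_eq_zero_iff k _).2 ⟨m, h, (neg_neg _).symm⟩

theorem poch_neg_nat_ne_zero {m k : ℕ} (h : k ≤ m) : poch (-(m : ℂ)) k ≠ 0 := by
  intro h0
  obtain ⟨j, hj, hjm⟩ := (ascPochhammer_eval_eq_zero_iff k _).1 h0
  rw [neg_neg, Nat.cast_inj] at hjm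
  omega

/-- According to the parity of n, one of the two numerator parameters is a non-positive integer. For
k > n the denominator vanishes too, and 0/0 = 0 gives the desired value. -/
theorem lucasCoeff_eq_zero {n k : ℕ} (h : (n + 1) / 2 < k) : lucasCoeff (-n) k = 0 := by
  obtain ⟨m, rfl | rfl⟩ := n.even_or_odd'
  · rw [lucasCoeff, show -((2 * m : ℕ) : ℂ) / 2 = -(m : ℂ) by push_cast; ring,
      poch_neg_nat_eq_zero (by omega), zero_mul, zero_div]
  · rw [lucasCoeff, show (-((2 * m + 1 : ℕ) : ℂ) - 1) / 2 = -((m + 1 : ℕ) : ℂ) by push_cast; ring,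
      poch_neg_nat_eq_zero (m := m + 1) (by omega), mul_zero, zero_div]

theorem fibCoeff_eq_zero {n k : ℕ} (h : n / 2 < k) : fibCoeff (-n) k = 0 := by
  obtain ⟨m, rfl | rfl⟩ := n.even_or_odd'
  · rw [fibCoeff, show -((2 * m : ℕ) : ℂ) / 2 = -(m : ℂ) by push_cast; ring,
      poch_neg_nat_eq_zero (by omega), mul_zero, zero_div]
  · rw [fibCoeff, show (-((2 * m + 1 : ℕ) : ℂ) + 1) / 2 = -(m : ℂ) by push_cast; ring,
      poch_neg_nat_eq_zero (by omega), zero_mul, zero_div]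

theorem poch_sub_one_succ (x : ℂ) (k : ℕ) : poch (x - 1) (k + 1) = (x - 1) * poch x k := by
  rw [poch_succ_left, sub_add_cancel]

theorem poch_sub_two_succ {x : ℂ} {k : ℕ} (h : x - 1 + k ≠ 0) :
    poch (x - 2) (k + 1) = (x - 2) * ((x - 1) * poch x k / (x - 1 + k)) := by
  rw [poch_succ_left, show x - 2 + 1 = x - 1 by ring, ← poch_sub_one_succ, poch_succ,
    mul_div_cancel_right₀ _ h]

/-- For x = -n, m = n + 1 and k ≤ m/2, the coefficient is (-1/4)^k times the Lucas polynomial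
coefficient m/(m-k) · binom(m-k, k), which obeys a Pascal rule. -/
theorem lucasCoeff_succ {x : ℂ} {k : ℕ} (h1 : x - 1 ≠ 0) (h2 : x - 2 ≠ 0) (hk : x - 1 + k ≠ 0)
    (hx : poch x k ≠ 0) :
    lucasCoeff (x - 2) (k + 1) = lucasCoeff (x - 1) (k + 1) - lucasCoeff x k / 4 := by
  have hf : (k.factorial : ℂ) ≠ 0 := Nat.cast_ne_zero.2 k.factorial_ne_zero
  have hk1 : (k : ℂ) + 1 ≠ 0 := Nat.cast_add_one_ne_zero k
  rw [lucasCoeff, lucasCoeff, lucasCoeff, poch_sub_two_succ hk, poch_sub_one_succ,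
    show (x - 2) / 2 = x / 2 - 1 by ring, show (x - 1 - 1) / 2 = x / 2 - 1 by ring,
    show (x - 2 - 1) / 2 = (x - 1) / 2 - 1 by ring, poch_sub_one_succ, poch_sub_one_succ,
    poch_succ ((x - 1) / 2), cast_factorial_succ]
  field_simp
  ring

/-- For x = -n and k ≤ n/2 the coefficient is (-1/4)^k binom(n-k, k), and this is Pascal's rule. -/
theorem fibCoeff_succ {x : ℂ} {k : ℕ} (h1 : x - 1 ≠ 0) (h2 : x - 2 ≠ 0) (hk : x - 1 + k ≠ 0)
    (hx : poch x k ≠ 0) :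
    fibCoeff (x - 2) (k + 1) = fibCoeff (x - 1) (k + 1) - fibCoeff x k / 4 := by
  have hf : (k.factorial : ℂ) ≠ 0 := Nat.cast_ne_zero.2 k.factorial_ne_zero
  have hk1 : (k : ℂ) + 1 ≠ 0 := Nat.cast_add_one_ne_zero k
  rw [fibCoeff, fibCoeff, fibCoeff, poch_sub_two_succ hk, poch_sub_one_succ,
    show (x - 2) / 2 = x / 2 - 1 by ring, show (x - 1) / 2 = (x + 1) / 2 - 1 by ring,
    show (x - 2 + 1) / 2 = (x + 1) / 2 - 1 by ring, show (x - 1 + 1) / 2 = x / 2 by ring,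
    poch_sub_one_succ, poch_sub_one_succ, poch_succ (x / 2), cast_factorial_succ]
  field_simp
  ring

theorem neg_nat_conditions {n k : ℕ} (hk : k ≤ n) :
    -(n : ℂ) - 1 ≠ 0 ∧ -(n : ℂ) - 2 ≠ 0 ∧ -(n : ℂ) - 1 + k ≠ 0 ∧ poch (-(n : ℂ)) k ≠ 0 := by
  obtain ⟨j, rfl⟩ := Nat.exists_eq_add_of_le hk
  refine ⟨fun h => ?_, fun h => ?_, fun h => ?_, poch_neg_nat_ne_zero hk⟩
  · exact Nat.cast_add_one_ne_zero (R := ℂ) (k + j) (by linear_combination -h)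
  · exact Nat.cast_add_one_ne_zero (R := ℂ) (k + j + 1) (by push_cast at h ⊢; linear_combination -h)
  · exact Nat.cast_add_one_ne_zero (R := ℂ) j (by push_cast at h; linear_combination -h)

theorem P_add_two (n : ℕ) (a b : ℂ) :
    P (n + 2) a b = P (n + 1) a b - b / (2 * a) * P n (a + 2) (b + 1) := by
  have h1 : (n + 2 + 1) / 2 = (n + 1) / 2 + 1 := by omega
  -- For odd n the sum for n + 1 ends one term before the one for n + 2; it is padded with a zero.
  rw [P_eq, P_eq, P_eq, h1, pochSum_extend (N := (n + 1 + 1) / 2) (N' := (n + 1) / 2 + 1) (by omega)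
    fun k hk => lucasCoeff_eq_zero hk,
    pochSum_succ (c₁ := lucasCoeff (-(n + 1 : ℕ))) (c₀ := lucasCoeff (-n)), add_div,
    div_self (two_ne_zero' ℂ), show 4 * (a / 2) = 2 * a by ring]
  · ring
  · simp [lucasCoeff, poch_zero]
  · intro k hk
    obtain ⟨c1, c2, c3, c4⟩ := neg_nat_conditions (n := n) (k := k) (by omega)
    have := lucasCoeff_succ c1 c2 c3 c4
    rwa [show -(n : ℂ) - 2 = -((n + 2 : ℕ) : ℂ) by push_cast; ring,
      show -(n : ℂ) - 1 = -((n + 1 : ℕ) : ℂ) by push_cast; ring] at this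

theorem Q_add_two (n : ℕ) (a b : ℂ) :
    Q (n + 2) a b = Q (n + 1) a b - b / (2 * (a + 1)) * Q n (a + 2) (b + 1) := by
  have h1 : (n + 2) / 2 = n / 2 + 1 := by omega
  rw [Q_eq, Q_eq, Q_eq, h1, pochSum_extend (N := (n + 1) / 2) (N' := n / 2 + 1) (by omega)
    fun k hk => fibCoeff_eq_zero hk,
    pochSum_succ (c₁ := fibCoeff (-(n + 1 : ℕ))) (c₀ := fibCoeff (-n)),
    show (a + 2 + 1) / 2 = (a + 1) / 2 + 1 by ring, show 4 * ((a + 1) / 2) = 2 * (a + 1) by ring]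
  · ring
  · simp [fibCoeff, poch_zero]
  · intro k hk
    obtain ⟨c1, c2, c3, c4⟩ := neg_nat_conditions (n := n) (k := k) (by omega)
    have := fibCoeff_succ c1 c2 c3 c4
    rwa [show -(n : ℂ) - 2 = -((n + 2 : ℕ) : ℂ) by push_cast; ring,
      show -(n : ℂ) - 1 = -((n + 1 : ℕ) : ℂ) by push_cast; ring] at this

theorem P_zero (a b : ℂ) : P 0 a b = 1 / 2 := by simp [P, terminating3F2, poch_zero]

theorem Q_zero (a b : ℂ) : Q 0 a b = 1 / 2 := by simp [Q, terminating3F2, poch_zero]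

theorem P_one (a b : ℂ) : P 1 a b = 1 / 2 - b / (2 * a) := by
  simp only [P, terminating3F2, Finset.sum_range_succ, Finset.sum_range_zero, poch_zero, poch_succ,
    Nat.reduceAdd, Nat.reduceDiv, Nat.factorial_zero, Nat.factorial_one, Nat.cast_one, Nat.cast_zero,
    add_zero, one_mul, zero_add]
  by_cases ha : a = 0
  · simp [ha]
  · field_simp
    ring_nf

theorem Q_one (a b : ℂ) : Q 1 a b = 1 / 2 := by simp [Q, terminating3F2, poch_zero]

/-! ### The generalized Kummer formula -/

theorem admissible_add_two {n : ℕ} {a b : ℂ} (h : Admissible (n + 2) a b) :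
    a ≠ 0 ∧ a + 1 ≠ 0 ∧ Admissible (n + 1) a b ∧ Admissible n (a + 2) (b + 1) := by
  obtain ⟨h1, h2⟩ := h
  have h3 : poch a (n + 1) ≠ 0 := by
    rw [poch_succ] at h1; exact left_ne_zero_of_mul h1
  rw [poch_succ_left, poch_succ_left, add_assoc, one_add_one_eq_two] at h1
  refine ⟨left_ne_zero_of_mul h1, left_ne_zero_of_mul (right_ne_zero_of_mul h1), ⟨h3, h2⟩,
    right_ne_zero_of_mul (right_ne_zero_of_mul h1), fun m => ?_⟩
  have := add_one_ne_neg_nat h2 m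
  rwa [show a - b + 1 = a + 2 - (b + 1) by ring] at this

theorem gauss2F1_eq_regular (n : ℕ) : ∀ {a b : ℂ}, Admissible n a b →
    gauss2F1 (a + n) b (a - b) (-1) =
      P n a b * regularTermP a b + Q n a b * regularTermQ a b := by
  induction n using Nat.twoStepInduction with
  | zero =>
    intro a b h
    rw [P_zero, Q_zero, Nat.cast_zero, add_zero, gauss2F1_self h.2]
  | one =>
    intro a b h
    have ha : a ≠ 0 := by simpa [poch_succ, poch_zero] using h.1
    rw [P_one, Q_one, Nat.cast_one, gauss2F1_one ha h.2]
  | more n ih₀ ih₁ =>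
    intro a b h
    obtain ⟨ha, ha1, h1, h2⟩ := admissible_add_two h
    have h0 : a - b ≠ 0 := by simpa using h.2 0
    rw [gauss2F1_shift n h.2, ih₁ h1, ih₀ h2, P_add_two, Q_add_two, regularTermP_shift ha h0,
      regularTermQ_shift ha1 h0]
    field_simp
    ring

theorem generalizedKummer {n : ℕ} {a b : ℂ} (h : Admissible n a b) :
    GeneralizedKummer n a b (P n a b) (Q n a b) := by
  rw [GeneralizedKummer, gammaTermP_eq h.2, gammaTermQ_eq h.2]
  exact gauss2F1_eq_regular n h


open MvPolynomial

/-! ### The coefficients as rational functions -/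

/-- The Pochhammer symbol of a polynomial. -/
def pochPoly (p : MvPolynomial (Fin 2) ℂ) (k : ℕ) : MvPolynomial (Fin 2) ℂ :=
  ∏ j ∈ Finset.range k, (p + C (j : ℂ))

theorem eval_pochPoly (x : Fin 2 → ℂ) (p : MvPolynomial (Fin 2) ℂ) (k : ℕ) :
    eval x (pochPoly p k) = poch (eval x p) k := by
  induction k with
  | zero => simp [pochPoly, poch_zero]
  | succ k ih =>
    rw [pochPoly, Finset.prod_range_succ, ← pochPoly, map_mul, ih, map_add, eval_C, poch_succ]

theorem poch_add (x : ℂ) (k m : ℕ) : poch x (k + m) = poch x k * poch (x + k) m := by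
  induction m with
  | zero => simp [poch_zero]
  | succ m ih =>
    rw [← add_assoc, poch_succ, ih, poch_succ]
    push_cast
    ring

/-- The numerator of `½ pochSum N c b d` over the denominator `(d)_N`, where `d` is a
polynomial. -/
def pochNumerator (N : ℕ) (c : ℕ → ℂ) (d : MvPolynomial (Fin 2) ℂ) : MvPolynomial (Fin 2) ℂ :=
  C (1 / 2) * ∑ k ∈ Finset.range (N + 1),
    C (c k) * (pochPoly (X 1) k * pochPoly (d + C (k : ℂ)) (N - k))

/-- The rational function `½ pochSum N c b d`, where `d` is a polynomial. -/
def pochRational (N : ℕ) (c : ℕ → ℂ) (d : MvPolynomial (Fin 2) ℂ) : RationalFunction :=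
  algebraMap _ RationalFunction (pochNumerator N c d) / algebraMap _ RationalFunction (pochPoly d N)

/-- All terms share the denominator (d)_N because (d)_N = (d)_k (d+k)_{N-k}. -/
theorem hasValueAt_pochRational (N : ℕ) (c : ℕ → ℂ) (d : MvPolynomial (Fin 2) ℂ) {a b : ℂ}
    (h : poch (eval ![a, b] d) N ≠ 0) :
    HasValueAt (pochRational N c d) a b (1 / 2 * pochSum N c b (eval ![a, b] d)) := by
  refine ⟨_, _, by rwa [eval_pochPoly], rfl, ?_⟩
  rw [eval_pochPoly, pochNumerator, map_mul, eval_C, map_sum, mul_div_assoc, Finset.sum_div,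
    pochSum]
  refine congrArg _ (Finset.sum_congr rfl fun k hk => ?_)
  obtain ⟨m, rfl⟩ := Nat.exists_eq_add_of_le (Nat.lt_succ_iff.1 (Finset.mem_range.1 hk))
  rw [poch_add] at h ⊢
  simp only [map_mul, map_add, eval_C, eval_pochPoly, Nat.add_sub_cancel_left, eval_X,
    Matrix.cons_val_one, Matrix.cons_val_fin_one]
  have h1 := left_ne_zero_of_mul h
  have h2 := right_ne_zero_of_mul h
  field_simp

theorem algebraMap_ne_zero_of_eval {g : MvPolynomial (Fin 2) ℂ} {x : Fin 2 → ℂ}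
    (hg : eval x g ≠ 0) : algebraMap _ RationalFunction g ≠ 0 := by
  rw [ne_eq, FaithfulSMul.algebraMap_eq_zero_iff]
  rintro rfl
  exact hg (map_zero _)

theorem HasValueAt.unique {R : RationalFunction} {a b u v : ℂ} (hu : HasValueAt R a b u)
    (hv : HasValueAt R a b v) : u = v := by
  obtain ⟨f, g, hg, hR, rfl⟩ := hu
  obtain ⟨f', g', hg', hR', rfl⟩ := hv
  rw [hR, div_eq_div_iff (algebraMap_ne_zero_of_eval hg) (algebraMap_ne_zero_of_eval hg'),
    ← map_mul, ← map_mul] at hR'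
  have h := congrArg (eval ![a, b]) (FaithfulSMul.algebraMap_injective _ _ hR')
  rw [map_mul, map_mul] at h
  rwa [div_eq_div_iff hg hg']

/-- Rational functions that agree on a box with infinite sides, wherever they and two further
rational functions are defined, are equal. -/
theorem eq_of_forall_hasValueAt {p p' q q' : RationalFunction} {s t : Set ℂ} (hs : s.Infinite)
    (ht : t.Infinite)
    (h : ∀ a ∈ s, ∀ b ∈ t, ∀ u u' v v' : ℂ, HasValueAt p a b u → HasValueAt p' a b u' →
      HasValueAt q a b v → HasValueAt q' a b v' → v = v') : q = q' := by
  obtain ⟨f₁, g₁, hg₁, rfl⟩ := IsFractionRing.div_surjective (MvPolynomial (Fin 2) ℂ) p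
  obtain ⟨f₂, g₂, hg₂, rfl⟩ := IsFractionRing.div_surjective (MvPolynomial (Fin 2) ℂ) p'
  obtain ⟨f₃, g₃, hg₃, rfl⟩ := IsFractionRing.div_surjective (MvPolynomial (Fin 2) ℂ) q
  obtain ⟨f₄, g₄, hg₄, rfl⟩ := IsFractionRing.div_surjective (MvPolynomial (Fin 2) ℂ) q'
  have hpoly : (f₃ * g₄ - f₄ * g₃) * (g₁ * g₂ * (g₃ * g₄)) = 0 := by
    refine MvPolynomial.funext_set ![s, t] (by simp [Fin.forall_fin_two, hs, ht]) fun x hx => ?_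
    obtain ⟨a, b, rfl⟩ : ∃ a b, x = ![a, b] :=
      ⟨x 0, x 1, by ext i; fin_cases i <;> rfl⟩
    have ha : a ∈ s := by simpa using hx 0 trivial
    have hb : b ∈ t := by simpa using hx 1 trivial
    -- Multiplying by all four denominators makes the polynomial vanish trivially at grid points
    -- where some fraction is not given by its chosen representative.
    rw [map_zero, map_mul, mul_eq_zero, or_iff_not_imp_right]
    intro hg
    simp only [map_mul, mul_ne_zero_iff, ← ne_eq] at hg
    obtain ⟨⟨h1, h2⟩, h3, h4⟩ := hg
    have := h a ha b hb _ _ _ _ ⟨f₁, g₁, h1, rfl, rfl⟩ ⟨f₂, g₂, h2, rfl, rfl⟩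
      ⟨f₃, g₃, h3, rfl, rfl⟩ ⟨f₄, g₄, h4, rfl, rfl⟩
    rw [div_eq_div_iff h3 h4] at this
    rw [map_sub, map_mul, map_mul, this, sub_self]
  have n1 := nonZeroDivisors.ne_zero hg₁
  have n2 := nonZeroDivisors.ne_zero hg₂
  have n3 := nonZeroDivisors.ne_zero hg₃
  have n4 := nonZeroDivisors.ne_zero hg₄
  have heq := sub_eq_zero.1 ((mul_eq_zero.1 hpoly).resolve_right
    (mul_ne_zero (mul_ne_zero n1 n2) (mul_ne_zero n3 n4)))
  rw [div_eq_div_iff (by simpa using n3) (by simpa using n4), ← map_mul, ← map_mul, heq]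

/-! ### Uniqueness of the coefficients -/

theorem infinite_range_sub_two_mul : (Set.range fun i : ℕ => (1 / 3 - 2 * i : ℂ)).Infinite :=
  Set.infinite_range_of_injective fun i j hij => by
    have : (i : ℂ) = j := by linear_combination -(1 / 2) * hij
    exact_mod_cast this

theorem infinite_range_add (x : ℂ) : (Set.range fun m : ℕ => x + (m : ℂ)).Infinite :=
  Set.infinite_range_of_injective fun i j hij => by
    have : (i : ℂ) = j := add_left_cancel hij
    exact_mod_cast this

theorem poch_one_third_sub_ne_zero (i n : ℕ) : poch (1 / 3 - 2 * i : ℂ) n ≠ 0 := by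
  refine poch_ne_zero_of_forall (fun k hk => ?_) n
  have : 1 + 3 * k = 6 * i := by
    have : (1 + 3 * k : ℂ) = 6 * i := by linear_combination 3 * hk
    exact_mod_cast this
  omega

/-- On this grid (a+1)/2 - b = -(i+m), which kills the P-term, while a and a - b are never integers.
-/
theorem admissible_gridP (n i m : ℕ) : Admissible n (1 / 3 - 2 * i) (2 / 3 + m) := by
  refine ⟨poch_one_third_sub_ne_zero i n, fun k hk => ?_⟩
  have : 1 + 6 * i + 3 * m = 3 * k := by
    have : (1 + 6 * i + 3 * m : ℂ) = 3 * k := by linear_combination -3 * hk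
    exact_mod_cast this
  omega

/-- Here a/2 - b = -(i+m), which kills the Q-term instead. -/
theorem admissible_gridQ (n i m : ℕ) : Admissible n (1 / 3 - 2 * i) (1 / 6 + m) := by
  refine ⟨poch_one_third_sub_ne_zero i n, fun k hk => ?_⟩
  have : 1 + 6 * k = 12 * i + 6 * m := by
    have : (1 + 6 * k : ℂ) = 12 * i + 6 * m := by linear_combination 6 * hk
    exact_mod_cast this
  omega

theorem two_mul_sqrt_pi_mul_cpow_ne_zero (a : ℂ) : 2 * (√Real.pi : ℂ) * 2 ^ (-a) ≠ 0 :=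
  mul_ne_zero (mul_ne_zero two_ne_zero sqrt_pi_ne_zero) (by simp [Complex.cpow_eq_zero_iff])

theorem gammaTermP_eq_zero (i m : ℕ) : gammaTermP (1 / 3 - 2 * i) (2 / 3 + m) = 0 := by
  rw [gammaTermP_eq (admissible_gridP 0 i m).2, regularTermP,
    show ((1 / 3 - 2 * i + 1) / 2 - (2 / 3 + m) : ℂ) = -((i + m : ℕ) : ℂ) by push_cast; ring,
    Complex.Gamma_neg_nat_eq_zero, inv_zero, mul_zero, mul_zero]

theorem gammaTermQ_ne_zero (i m : ℕ) : gammaTermQ (1 / 3 - 2 * i) (2 / 3 + m) ≠ 0 := by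
  rw [gammaTermQ_eq (admissible_gridP 0 i m).2, regularTermQ]
  refine mul_ne_zero (mul_ne_zero (two_mul_sqrt_pi_mul_cpow_ne_zero _)
    (Complex.Gamma_ne_zero (admissible_gridP 0 i m).2)) (mul_ne_zero
    (inv_ne_zero (Complex.Gamma_ne_zero fun k hk => ?_))
    (inv_ne_zero (Complex.Gamma_ne_zero fun k hk => ?_)))
  · have : 2 + 3 * k = 3 * i := by
      have : (2 + 3 * k : ℂ) = 3 * i := by linear_combination 3 * hk
      exact_mod_cast this
    omega
  · have : 1 + 2 * i + 2 * m = 2 * k := by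
      have : (1 + 2 * i + 2 * m : ℂ) = 2 * k := by linear_combination -2 * hk
      exact_mod_cast this
    omega

theorem gammaTermQ_eq_zero (i m : ℕ) : gammaTermQ (1 / 3 - 2 * i) (1 / 6 + m) = 0 := by
  rw [gammaTermQ_eq (admissible_gridQ 0 i m).2, regularTermQ,
    show ((1 / 3 - 2 * i) / 2 - (1 / 6 + m) : ℂ) = -((i + m : ℕ) : ℂ) by push_cast; ring,
    Complex.Gamma_neg_nat_eq_zero, inv_zero, mul_zero, mul_zero]

theorem gammaTermP_ne_zero (i m : ℕ) : gammaTermP (1 / 3 - 2 * i) (1 / 6 + m) ≠ 0 := by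
  rw [gammaTermP_eq (admissible_gridQ 0 i m).2, regularTermP]
  refine mul_ne_zero (mul_ne_zero (two_mul_sqrt_pi_mul_cpow_ne_zero _)
    (Complex.Gamma_ne_zero (admissible_gridQ 0 i m).2)) (mul_ne_zero
    (inv_ne_zero (Complex.Gamma_ne_zero fun k hk => ?_))
    (inv_ne_zero (Complex.Gamma_ne_zero fun k hk => ?_)))
  · have : 1 + 6 * k = 6 * i := by
      have : (1 + 6 * k : ℂ) = 6 * i := by linear_combination 6 * hk
      exact_mod_cast this
    omega
  · have : 1 + 2 * k = 2 * i + 2 * m := by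
      have : (1 + 2 * k : ℂ) = 2 * i + 2 * m := by linear_combination 2 * hk
      exact_mod_cast this
    omega

/-- Where one Gamma term is zero, the formula can be divided by the other and determines the value
of the remaining coefficient; the grid is large enough to identify a rational function. -/
theorem IsCoefficientPair.unique {n : ℕ} {p q p' q' : RationalFunction}
    (h : IsCoefficientPair n p q) (h' : IsCoefficientPair n p' q') : p' = p ∧ q' = q := by
  constructor
  · refine (eq_of_forall_hasValueAt (p := q) (p' := q') infinite_range_sub_two_mul
      (infinite_range_add (1 / 6)) ?_).symm
    rintro _ ⟨i, rfl⟩ _ ⟨m, rfl⟩ v v' u u' hv hv' hu hu'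
    have hA := admissible_gridQ n i m
    have h1 := (h _ _ _ _ hA hu hv).symm.trans (h' _ _ _ _ hA hu' hv')
    rw [gammaTermQ_eq_zero, mul_zero, mul_zero, add_zero, add_zero] at h1
    exact mul_right_cancel₀ (gammaTermP_ne_zero i m) h1
  · refine (eq_of_forall_hasValueAt (p := p) (p' := p') infinite_range_sub_two_mul
      (infinite_range_add (2 / 3)) ?_).symm
    rintro _ ⟨i, rfl⟩ _ ⟨m, rfl⟩ u u' v v' hu hu' hv hv'
    have hA := admissible_gridP n i m
    have h1 := (h _ _ _ _ hA hu hv).symm.trans (h' _ _ _ _ hA hu' hv')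
    rw [gammaTermP_eq_zero, mul_zero, mul_zero, zero_add, zero_add] at h1
    exact mul_right_cancel₀ (gammaTermQ_ne_zero i m) h1

/-! ### The coefficients are defined at all admissible points -/

/-- The factors of (a/2)_k are halves of the even-indexed factors of (a)_n; those of ((a+1)/2)_k in
the next lemma are halves of the odd-indexed ones. -/
theorem poch_half_ne_zero {n : ℕ} {a : ℂ} (h : poch a n ≠ 0) : poch (a / 2) ((n + 1) / 2) ≠ 0 := by
  contrapose! h
  obtain ⟨j, hj, hja⟩ := (ascPochhammer_eval_eq_zero_iff _ _).1 h
  exact (ascPochhammer_eval_eq_zero_iff _ _).2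
    ⟨2 * j, by omega, by push_cast; linear_combination 2 * hja⟩

theorem poch_add_one_half_ne_zero {n : ℕ} {a : ℂ} (h : poch a n ≠ 0) :
    poch ((a + 1) / 2) (n / 2) ≠ 0 := by
  contrapose! h
  obtain ⟨j, hj, hja⟩ := (ascPochhammer_eval_eq_zero_iff _ _).1 h
  exact (ascPochhammer_eval_eq_zero_iff _ _).2
    ⟨2 * j + 1, by omega, by push_cast; linear_combination 2 * hja⟩

/-- The coefficient `P n` as a rational function. -/
def rationalP (n : ℕ) : RationalFunction :=
  pochRational ((n + 1) / 2) (lucasCoeff (-n)) (C (1 / 2) * X 0)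

/-- The coefficient `Q n` as a rational function. -/
def rationalQ (n : ℕ) : RationalFunction :=
  pochRational (n / 2) (fibCoeff (-n)) (C (1 / 2) * (X 0 + C 1))

theorem hasValueAt_rationalP {n : ℕ} {a b : ℂ} (h : Admissible n a b) :
    HasValueAt (rationalP n) a b (P n a b) := by
  have he : eval ![a, b] (C (1 / 2) * X 0 : MvPolynomial (Fin 2) ℂ) = a / 2 := by
    simp only [map_mul, eval_C, eval_X, Matrix.cons_val_zero]; ring
  have hv := hasValueAt_pochRational ((n + 1) / 2) (lucasCoeff (-n)) (C (1 / 2) * X 0) (a := a)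
    (b := b) (by rw [he]; exact poch_half_ne_zero h.1)
  rwa [he, ← P_eq] at hv

theorem hasValueAt_rationalQ {n : ℕ} {a b : ℂ} (h : Admissible n a b) :
    HasValueAt (rationalQ n) a b (Q n a b) := by
  have he : eval ![a, b] (C (1 / 2) * (X 0 + C 1) : MvPolynomial (Fin 2) ℂ) = (a + 1) / 2 := by
    simp only [map_mul, map_add, eval_C, eval_X, Matrix.cons_val_zero]; ring
  have hv := hasValueAt_pochRational (n / 2) (fibCoeff (-n)) (C (1 / 2) * (X 0 + C 1)) (a := a)
    (b := b) (by rw [he]; exact poch_add_one_half_ne_zero h.1)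
  rwa [he, ← Q_eq] at hv

theorem isCoefficientPair_rational (n : ℕ) : IsCoefficientPair n (rationalP n) (rationalQ n) := by
  intro a b u v h hu hv
  rw [hu.unique (hasValueAt_rationalP h), hv.unique (hasValueAt_rationalQ h)]
  exact generalizedKummer h

end Kummer

end

theorem theorem2 (n : ℕ) :
    (∀ a b : ℂ, Kummer.Admissible n a b →
      Kummer.IsGaussContinuation (a + n) b (a - b) (Kummer.gauss2F1 (a + n) b (a - b)) ∧
      Kummer.gauss2F1 (a + n) b (a - b) (-1) =
        Kummer.P n a b * Kummer.gammaTermP a b + Kummer.Q n a b * Kummer.gammaTermQ a b) ∧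
    ∃ p q : Kummer.RationalFunction,
      Kummer.IsCoefficientPair n p q ∧
      (∀ p' q' : Kummer.RationalFunction,
        Kummer.IsCoefficientPair n p' q' → p' = p ∧ q' = q) ∧
      ∀ a b : ℂ, Kummer.Admissible n a b →
        Kummer.HasValueAt p a b (Kummer.P n a b) ∧ Kummer.HasValueAt q a b (Kummer.Q n a b) := by
  refine ⟨fun a b h => ⟨Kummer.isGaussContinuation_gauss2F1 h.2, Kummer.generalizedKummer h⟩,
    Kummer.rationalP n, Kummer.rationalQ n, Kummer.isCoefficientPair_rational n,
    fun p' q' h => (Kummer.isCoefficientPair_rational n).unique h,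
    fun a b h => ⟨Kummer.hasValueAt_rationalP h, Kummer.hasValueAt_rationalQ h⟩⟩
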